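/- Let $V_1,V_2>0$ be the $C^2$ solution on $\mathbb{R}$ of $-V_1''+V_1V_2^2=0$, $-V_2''+V_2V_1^2=0$ with $V_1(0)=V_2(0)=1$, $V_1(-x)=V_2(x)$ and $V_1'(x)>0$ for $x\in\mathbb{R}$, and such that, for some constants $A>0$, $B\in\mathbb{R}$, $c>0$, $$V_1(x)=Ax+B+\mathcal{O}(e^{-cx^2})\ \text{ as } x\to+\infty,\qquad V_1(x)=\mathcal{O}(e^{-cx^2})\ \text{ as } x\to-\infty .$$ For $\omega\ge 0$ and $\varphi=(\varphi_1,\varphi_2)$ set $$L_\omega\varphi=\bigl(-\varphi_1''+V_2^2\varphi_1+2V_1V_2\varphi_2+\omega^2\varphi_1,\ \ -\varphi_2''+V_1^2\varphi_2+2V_1V_2\varphi_1+\omega^2\varphi_2\bigr),$$ and write $\|f\|_{C^0((-R,R))}=\sup_{|x|<R}\max(|f_1(x)|,|f_2(x)|)$ and $\|g\|_{C^0_\theta((-R,R))}=\|g\cosh(\theta x)\|_{C^0((-R,R))}$. Given $\theta>0$, there exist constants $C,R_0,\omega_0,P_0>0$ such that the following holds for all $R>R_0$ and all $\omega\in(0,\omega_0)$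 with $\omega R>P_0$. If $\varphi\in C^2((-R,R))\cap C([-R,R])$ satisfies $$L_\omega\varphi=g\ \text{ in } (-R,R),\qquad \varphi(\pm R)=0,$$ and $$\int_{-R}^{R}\left(V_1'g_1+V_2'g_2\right)dx=0,$$ then $$\|\varphi\|_{C^0((-R,R))}\le C\,\|g\|_{C^0_\theta((-R,R))}.$$ In particular $C$ does not depend on $\omega$, $R$, $\varphi$ or $g$. -/

import Mathlib

open Set Filter Asymptotics
open scoped ENNReal

/-- The pair `(V₁, V₂)` is the (normalized, symmetric, monotone) one dimensional profile: a positive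
classical solution on `ℝ` of `-V₁'' + V₁ V₂² = 0`, `-V₂'' + V₂ V₁² = 0` with
`V₁(0) = V₂(0) = 1`, `V₁(-x) = V₂(x)`, `V₁' > 0`, `V₁(x) = A x + B + O(exp(-c x²))` as `x → +∞`
and `V₁(x) = O(exp(-c x²))` as `x → -∞`, for some `A > 0`, `B ∈ ℝ`, `c > 0`. -/
structure IsSegregationProfile (V₁ V₂ : ℝ → ℝ) : Prop where
  contDiff_fst : ContDiff ℝ 2 V₁
  contDiff_snd : ContDiff ℝ 2 V₂
  pos_fst : ∀ x, 0 < V₁ x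
  pos_snd : ∀ x, 0 < V₂ x
  eq_fst : ∀ x, -deriv (deriv V₁) x + V₁ x * V₂ x ^ 2 = 0
  eq_snd : ∀ x, -deriv (deriv V₂) x + V₂ x * V₁ x ^ 2 = 0
  fst_zero : V₁ 0 = 1
  snd_zero : V₂ 0 = 1
  symm : ∀ x, V₁ (-x) = V₂ x
  deriv_pos : ∀ x, 0 < deriv V₁ x
  asymptotics : ∃ A B c : ℝ, 0 < A ∧ 0 < c ∧
    ((fun x => V₁ x - (A * x + B)) =O[atTop] fun x => Real.exp (-c * x ^ 2)) ∧
    (V₁ =O[atBot] fun x => Real.exp (-c * x ^ 2))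

/-- The linearized operator
`L_ω φ = (-φ₁'' + V₂² φ₁ + 2 V₁ V₂ φ₂ + ω² φ₁, 2 V₁ V₂ φ₁ - φ₂'' + V₁² φ₂ + ω² φ₂)`. -/
noncomputable def linearizedOp (V₁ V₂ : ℝ → ℝ) (ω : ℝ) (φ : ℝ → ℝ × ℝ) (x : ℝ) : ℝ × ℝ :=
  (-deriv (deriv fun y => (φ y).1) x + V₂ x ^ 2 * (φ x).1 + 2 * V₁ x * V₂ x * (φ x).2
      + ω ^ 2 * (φ x).1,
   2 * V₁ x * V₂ x * (φ x).1 - deriv (deriv fun y => (φ y).2) x + V₁ x ^ 2 * (φ x).2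
      + ω ^ 2 * (φ x).2)

/-- `φ` is a classical solution of the Dirichlet problem `L_ω φ = g` in `(-R, R)`, `φ(±R) = 0`. -/
structure IsDirichletSolution (V₁ V₂ : ℝ → ℝ) (ω R : ℝ) (φ g : ℝ → ℝ × ℝ) : Prop where
  contDiffOn : ContDiffOn ℝ 2 φ (Ioo (-R) R)
  continuousOn : ContinuousOn φ (Icc (-R) R)
  eq : ∀ x ∈ Ioo (-R) R, linearizedOp V₁ V₂ ω φ x = g x
  left : φ (-R) = 0
  right : φ R = 0

/-- The uniform norm `‖f‖_{C⁰(s)} = sup_{x ∈ s} max (|f₁(x)|, |f₂(x)|)`, equal to `∞` when `f` is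
unbounded on `s`. -/
noncomputable def c0Norm (s : Set ℝ) (f : ℝ → ℝ × ℝ) : ℝ≥0∞ := ⨆ x ∈ s, ‖f x‖ₑ

/-- The weighted norm `‖g‖_{C⁰_θ(s)} = ‖g cosh(θ x)‖_{C⁰(s)}`. -/
noncomputable def c0WeightedNorm (θ : ℝ) (s : Set ℝ) (g : ℝ → ℝ × ℝ) : ℝ≥0∞ :=
  c0Norm s fun x => Real.cosh (θ * x) • g x

/-!
The pair `V' = (V₁', V₂')` spans the bounded kernel of `L₀`, so the estimate amounts to controlling the
multiple `c V'` contained in a solution `φ`, and everything else. Both are done by explicit inequalities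
which show that any bound `N` of `|φ|` improves to `C G + N / 2`, where `G` is the weighted norm of `g`;
applied to `N = max |φ|` this gives the claim.

* *Inner region* (`exists_near_kernel`). Since `(V₁', -V₂')` is a positive solution of the cooperative
  system obtained by changing the sign of the second component, Picone's identity writes the quadratic
  form of `L_ω` as a sum of squares of the derivatives of `u = φ₁ / V₁'`, `v = φ₂ / V₂'` and of `u - v`.
  The form equals `∫ φ · g`, which is `O(NG)`, so on a fixed interval `[-a, a]` the solution is within
  `O(√(NG))` of a multiple `c V'`.
* *Outer region* (`abs_le_of_inner`). For `x ≥ a` the first component satisfies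
  `-φ₁'' + ω² φ₁ = O(G exp (-θ x) + N exp (-2x))` and the second one is governed by the potential
  `V₁² ≥ 1`; barriers bound both by their values at `a` plus `O(G + N exp (-2a))`.
* *Solvability condition* (`abs_coeff_le`). Testing the equation with
  `sinh (ω (R - |x|)) / sinh (ω R) · V'` and subtracting the orthogonality relation, every term has a
  factor `ω`, and after division by it there remains `2 coth (ω R) c |V'(a)|² = O(G + √(NG))`, up to
  small multiples of `N` and of `c`. Here `ω R > 1` keeps `coth (ω R)` bounded.

Instead of integrating, inequalities between derivatives are used throughout: a function whose
derivative is bounded by that of an explicit function has bounded increments.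
-/

/-! ### Calculus on an interval -/

/-- One dimensional weak maximum principle: a function which is concave where it is negative and
nonnegative at both ends is nonnegative. -/
lemma nonneg_of_second_deriv_neg {w w' w'' : ℝ → ℝ} {a b : ℝ} (hc : ContinuousOn w (Icc a b))
    (h1 : ∀ x ∈ Ioo a b, HasDerivAt w (w' x) x) (h2 : ∀ x ∈ Ioo a b, HasDerivAt w' (w'' x) x)
    (ha : 0 ≤ w a) (hb : 0 ≤ w b) (hneg : ∀ x ∈ Ioo a b, w x < 0 → w'' x < 0) :
    ∀ x ∈ Icc a b, 0 ≤ w x := by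
  intro x hx
  obtain ⟨z, hz, hmin⟩ := isCompact_Icc.exists_isMinOn ⟨x, hx⟩ hc
  by_contra! hlt
  have hzneg : w z < 0 := (hmin hx).trans_lt hlt
  have hza : a < z := lt_of_le_of_ne hz.1 (by rintro rfl; linarith)
  have hzb : z < b := lt_of_le_of_ne hz.2 (by rintro rfl; linarith)
  have hzI : z ∈ Ioo a b := ⟨hza, hzb⟩
  have hloc : IsLocalMin w z := hmin.isLocalMin (Icc_mem_nhds hza hzb)
  have hd0 : w' z = 0 := hloc.hasDerivAt_eq_zero (h1 z hzI)
  have hev : deriv w =ᶠ[nhds z] w' := by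
    filter_upwards [Ioo_mem_nhds hza hzb] with y hy using (h1 y hy).deriv
  have hdd : deriv (deriv w) z = w'' z := by rw [hev.deriv_eq, (h2 z hzI).deriv]
  have hmax : IsLocalMax w z :=
    isLocalMax_of_deriv_deriv_neg (hdd ▸ hneg z hzI hzneg) (by rw [(h1 z hzI).deriv, hd0])
      (h1 z hzI).continuousAt
  -- being both a local minimum and a local maximum, `z` has a neighbourhood on which `w` is constant
  have hconst : w =ᶠ[nhds z] fun _ => w z := by
    filter_upwards [hloc, hmax] with y h h' using le_antisymm h' h
  have : deriv w =ᶠ[nhds z] fun _ => 0 := by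
    filter_upwards [hconst.eventuallyEq_nhds] with y hy
    rw [hy.deriv_eq, deriv_const]
  have h0 : deriv (deriv w) z = 0 := by rw [this.deriv_eq, deriv_const]
  linarith [hneg z hzI hzneg]

lemma le_of_hasDerivAt_nonneg {f f' : ℝ → ℝ} {x y : ℝ} (hxy : x ≤ y)
    (hc : ContinuousOn f (Icc x y)) (hd : ∀ z ∈ Ioo x y, HasDerivAt f (f' z) z)
    (h0 : ∀ z ∈ Ioo x y, 0 ≤ f' z) : f x ≤ f y := by
  refine monotoneOn_of_deriv_nonneg (convex_Icc x y) hc ?_ ?_ (left_mem_Icc.2 hxy)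
    (right_mem_Icc.2 hxy) hxy
  · rw [interior_Icc]
    exact fun z hz => (hd z hz).differentiableAt.differentiableWithinAt
  · rw [interior_Icc]
    exact fun z hz => (hd z hz).deriv ▸ h0 z hz

lemma abs_sub_le_of_abs_deriv_le {f f' b b' : ℝ → ℝ} {x y : ℝ} (hxy : x ≤ y)
    (hf : ContinuousOn f (Icc x y)) (hb : ContinuousOn b (Icc x y))
    (hf' : ∀ z ∈ Ioo x y, HasDerivAt f (f' z) z) (hb' : ∀ z ∈ Ioo x y, HasDerivAt b (b' z) z)
    (hle : ∀ z ∈ Ioo x y, |f' z| ≤ b' z) : |f y - f x| ≤ b y - b x := by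
  have h1 := le_of_hasDerivAt_nonneg hxy (hb.sub hf)
    (fun z hz => (hb' z hz).sub (hf' z hz)) (fun z hz => by linarith [(abs_le.1 (hle z hz)).2])
  have h2 := le_of_hasDerivAt_nonneg hxy (hb.add hf)
    (fun z hz => (hb' z hz).add (hf' z hz)) (fun z hz => by linarith [(abs_le.1 (hle z hz)).1])
  simp only [Pi.sub_apply, Pi.add_apply] at h1 h2
  exact abs_le.2 ⟨by linarith, by linarith⟩

/-! ### Properties of the profile -/

namespace IsSegregationProfile

lemma hasDerivAt_fst {V₁ V₂ : ℝ → ℝ} (hV : IsSegregationProfile V₁ V₂) (x : ℝ) :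
    HasDerivAt V₁ (deriv V₁ x) x :=
  (hV.contDiff_fst.differentiable (by norm_num) x).hasDerivAt

lemma hasDerivAt_snd {V₁ V₂ : ℝ → ℝ} (hV : IsSegregationProfile V₁ V₂) (x : ℝ) :
    HasDerivAt V₂ (deriv V₂ x) x :=
  (hV.contDiff_snd.differentiable (by norm_num) x).hasDerivAt

lemma hasDerivAt_deriv_fst {V₁ V₂ : ℝ → ℝ} (hV : IsSegregationProfile V₁ V₂) (x : ℝ) :
    HasDerivAt (deriv V₁) (V₁ x * V₂ x ^ 2) x := by
  have h : ContDiff ℝ 1 (deriv V₁) := ((contDiff_succ_iff_deriv (n := 1)).1 hV.contDiff_fst).2.2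
  have := (h.differentiable (by norm_num) x).hasDerivAt
  rwa [show deriv (deriv V₁) x = V₁ x * V₂ x ^ 2 by linarith [hV.eq_fst x]] at this

lemma hasDerivAt_deriv_snd {V₁ V₂ : ℝ → ℝ} (hV : IsSegregationProfile V₁ V₂) (x : ℝ) :
    HasDerivAt (deriv V₂) (V₂ x * V₁ x ^ 2) x := by
  have h : ContDiff ℝ 1 (deriv V₂) := ((contDiff_succ_iff_deriv (n := 1)).1 hV.contDiff_snd).2.2
  have := (h.differentiable (by norm_num) x).hasDerivAt
  rwa [show deriv (deriv V₂) x = V₂ x * V₁ x ^ 2 by linarith [hV.eq_snd x]] at this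

lemma symm' {V₁ V₂ : ℝ → ℝ} (hV : IsSegregationProfile V₁ V₂) (x : ℝ) : V₂ (-x) = V₁ x := by
  rw [← hV.symm, neg_neg]

lemma deriv_snd {V₁ V₂ : ℝ → ℝ} (hV : IsSegregationProfile V₁ V₂) (x : ℝ) :
    deriv V₂ x = -deriv V₁ (-x) := by
  rw [show V₂ = fun y => V₁ (-y) from funext fun y => (hV.symm y).symm, deriv_comp_neg]

lemma deriv_fst_neg {V₁ V₂ : ℝ → ℝ} (hV : IsSegregationProfile V₁ V₂) (x : ℝ) :
    deriv V₁ (-x) = -deriv V₂ x := by rw [hV.deriv_snd, neg_neg]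

lemma deriv_snd_neg {V₁ V₂ : ℝ → ℝ} (hV : IsSegregationProfile V₁ V₂) (x : ℝ) :
    deriv V₂ (-x) = -deriv V₁ x := by rw [hV.deriv_snd, neg_neg]

lemma deriv_snd_lt_zero {V₁ V₂ : ℝ → ℝ} (hV : IsSegregationProfile V₁ V₂) (x : ℝ) :
    deriv V₂ x < 0 := by
  rw [hV.deriv_snd]; linarith [hV.deriv_pos (-x)]

lemma monotone_fst {V₁ V₂ : ℝ → ℝ} (hV : IsSegregationProfile V₁ V₂) : Monotone V₁ :=
  monotone_of_deriv_nonneg (fun x => (hV.hasDerivAt_fst x).differentiableAt)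
    fun x => (hV.deriv_pos x).le

lemma monotone_deriv_fst {V₁ V₂ : ℝ → ℝ} (hV : IsSegregationProfile V₁ V₂) :
    Monotone (deriv V₁) :=
  monotone_of_deriv_nonneg (fun x => (hV.hasDerivAt_deriv_fst x).differentiableAt) fun x => by
    rw [(hV.hasDerivAt_deriv_fst x).deriv]
    have := hV.pos_fst x
    positivity

lemma one_le_fst {V₁ V₂ : ℝ → ℝ} (hV : IsSegregationProfile V₁ V₂) {x : ℝ} (hx : 0 ≤ x) :
    1 ≤ V₁ x := hV.fst_zero ▸ hV.monotone_fst hx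

lemma snd_le_one {V₁ V₂ : ℝ → ℝ} (hV : IsSegregationProfile V₁ V₂) {x : ℝ} (hx : 0 ≤ x) :
    V₂ x ≤ 1 := by
  rw [← hV.symm, ← hV.fst_zero]; exact hV.monotone_fst (by linarith)

/-- The slope of the convex function `V₁` stays below its increments over unit intervals, which the
affine asymptotics bounds near `+∞`. -/
lemma exists_deriv_fst_le {V₁ V₂ : ℝ → ℝ} (hV : IsSegregationProfile V₁ V₂) :
    ∃ M : ℝ, 0 < M ∧ ∀ x, deriv V₁ x ≤ M := by
  obtain ⟨A, B, c, hA, hc, h, -⟩ := hV.asymptotics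
  obtain ⟨C, hC0, hC⟩ := h.exists_pos
  obtain ⟨X, hX⟩ := eventually_atTop.1 hC.bound
  have hbd : ∀ y, X ≤ y → |V₁ y - (A * y + B)| ≤ C := by
    intro y hy
    have h1 := hX y hy
    rw [Real.norm_eq_abs, Real.norm_eq_abs, Real.abs_exp] at h1
    have : Real.exp (-c * y ^ 2) ≤ 1 := by
      rw [Real.exp_le_one_iff]; nlinarith [sq_nonneg y]
    nlinarith
  refine ⟨A + 2 * C, by positivity, fun x => ?_⟩
  set y := max x X
  have hmvt := exists_hasDerivAt_eq_slope V₁ (deriv V₁) (show y < y + 1 by linarith)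
    (fun z _ => (hV.hasDerivAt_fst z).continuousAt.continuousWithinAt)
    (fun z _ => hV.hasDerivAt_fst z)
  obtain ⟨ξ, hξ, hs⟩ := hmvt
  have h1 := abs_le.1 (hbd y (le_max_right _ _))
  have h2 := abs_le.1 (hbd (y + 1) ((le_max_right x X).trans (by linarith)))
  have h3 : deriv V₁ x ≤ deriv V₁ ξ :=
    hV.monotone_deriv_fst ((le_max_left x X).trans hξ.1.le)
  have h4 : deriv V₁ ξ = V₁ (y + 1) - V₁ y := by rw [hs]; simp
  linarith [h1.1, h2.2]

/-- The interaction terms decay at `+∞`; since `V₂ ≤ 1 ≤ V₁` on the half line, `V₂ V₁²` dominates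
all the others. -/
lemma exists_snd_mul_sq_fst_le {V₁ V₂ : ℝ → ℝ} (hV : IsSegregationProfile V₁ V₂) :
    ∃ K : ℝ, 0 < K ∧ ∀ x, 0 ≤ x → V₂ x * V₁ x ^ 2 ≤ K * Real.exp (-2 * x) := by
  obtain ⟨M, hM0, hM⟩ := hV.exists_deriv_fst_le
  obtain ⟨A, B, c, hA, hc, -, h⟩ := hV.asymptotics
  obtain ⟨C, hC0, hC⟩ := h.exists_pos
  obtain ⟨X, hX⟩ := eventually_atBot.1 hC.bound
  have hlin : ∀ x, 0 ≤ x → V₁ x ^ 2 ≤ (1 + M) ^ 2 * Real.exp (2 * x) := by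
    intro x hx
    have h1 := le_of_hasDerivAt_nonneg hx (f := fun y => 1 + M * y - V₁ y)
      (f' := fun y => M - deriv V₁ y)
      (fun z _ => ContinuousAt.continuousWithinAt
        (by have := (hV.hasDerivAt_fst z).continuousAt; fun_prop))
      (fun z _ => by
        simpa using
          (((hasDerivAt_id z).const_mul M).const_add 1).fun_sub (hV.hasDerivAt_fst z))
      (fun z _ => by linarith [hM z])
    simp only [hV.fst_zero] at h1
    have h2 : V₁ x ≤ (1 + M) * Real.exp x := by
      have := Real.add_one_le_exp x
      nlinarith
    calc V₁ x ^ 2 ≤ ((1 + M) * Real.exp x) ^ 2 := by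
          have := (hV.pos_fst x).le
          gcongr
      _ = (1 + M) ^ 2 * Real.exp (2 * x) := by
          rw [mul_pow, ← Real.exp_nat_mul]; norm_num
  set Z := max (-X) (4 / c) with hZ
  have hZ0 : 0 < Z := lt_of_lt_of_le (by positivity) (le_max_right _ _)
  refine ⟨(1 + M) ^ 2 * (C + Real.exp (4 * Z)), by positivity, fun x hx => ?_⟩
  have key : V₂ x ≤ (C + Real.exp (4 * Z)) * Real.exp (-4 * x) := by
    rcases le_total x Z with hxZ | hxZ
    · have h1 : 1 ≤ Real.exp (4 * Z) * Real.exp (-4 * x) := by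
        rw [← Real.exp_add, Real.one_le_exp_iff]; linarith
      nlinarith [hV.snd_le_one hx, Real.exp_pos (-4 * x)]
    · have h1 := hX (-x) (by linarith [le_max_left (-X) (4 / c)])
      rw [Real.norm_eq_abs, Real.norm_eq_abs, Real.abs_exp, hV.symm, abs_of_pos (hV.pos_snd x)] at h1
      have h2 : Real.exp (-c * (-x) ^ 2) ≤ Real.exp (-4 * x) := by
        rw [Real.exp_le_exp]
        have : 4 ≤ x * c := (div_le_iff₀ hc).1 ((le_max_right _ _).trans hxZ)
        nlinarith
      nlinarith [Real.exp_pos (-4 * x), Real.exp_pos (4 * Z)]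
  calc V₂ x * V₁ x ^ 2
      ≤ ((C + Real.exp (4 * Z)) * Real.exp (-4 * x)) * ((1 + M) ^ 2 * Real.exp (2 * x)) := by
        gcongr
        exact hlin x hx
    _ = (1 + M) ^ 2 * (C + Real.exp (4 * Z)) * (Real.exp (-4 * x) * Real.exp (2 * x)) := by ring
    _ = _ := by rw [← Real.exp_add]; ring_nf

lemma abs_deriv_fst_le {V₁ V₂ : ℝ → ℝ} (hV : IsSegregationProfile V₁ V₂) {M : ℝ}
    (hM : ∀ x, deriv V₁ x ≤ M) (x : ℝ) : |deriv V₁ x| ≤ M := by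
  rw [abs_of_pos (hV.deriv_pos x)]; exact hM x

lemma abs_deriv_snd_le {V₁ V₂ : ℝ → ℝ} (hV : IsSegregationProfile V₁ V₂) {M : ℝ}
    (hM : ∀ x, deriv V₁ x ≤ M) (x : ℝ) : |deriv V₂ x| ≤ M := by
  rw [hV.deriv_snd, abs_neg]; exact hV.abs_deriv_fst_le hM _

lemma interaction_bounds {V₁ V₂ : ℝ → ℝ} (hV : IsSegregationProfile V₁ V₂) {K : ℝ}
    (hK : ∀ x, 0 ≤ x → V₂ x * V₁ x ^ 2 ≤ K * Real.exp (-2 * x)) {x : ℝ} (hx : 0 ≤ x) :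
    V₂ x ^ 2 ≤ K * Real.exp (-2 * x) ∧ V₁ x * V₂ x ≤ K * Real.exp (-2 * x) ∧
      V₁ x * V₂ x ^ 2 ≤ K * Real.exp (-2 * x) := by
  have h1 := hV.one_le_fst hx
  have h2 := hV.snd_le_one hx
  have h3 := hV.pos_snd x
  have h5 : V₁ x ≤ V₁ x ^ 2 := by nlinarith
  have h6 : V₂ x ^ 2 ≤ V₂ x := by nlinarith
  have a : V₁ x * V₂ x ≤ K * Real.exp (-2 * x) := by nlinarith [hK x hx]
  have b : V₁ x * V₂ x ^ 2 ≤ V₁ x * V₂ x := mul_le_mul_of_nonneg_left h6 (by linarith)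
  exact ⟨by nlinarith, a, b.trans a⟩

end IsSegregationProfile

/-! ### Bounded solutions in first order form -/

/-- A solution `(p, q)` of `L_ω (p, q) = (g₁, g₂)` on `(-R, R)` with zero boundary values, written in
first order form, with `|p|, |q| ≤ N` and `|g₁|, |g₂| ≤ G / cosh (θ x)`. The derivatives `p'`, `q'` are
taken continuous up to the boundary. The solvability condition is encoded through a primitive `Y` of
`V₁' g₁ + V₂' g₂` with equal values at `±R`. -/
structure IsBoundedSolution (V₁ V₂ : ℝ → ℝ) (ω R θ N G : ℝ) (p q p' q' g₁ g₂ Y : ℝ → ℝ) :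
    Prop where
  cont_p : ContinuousOn p (Icc (-R) R)
  cont_q : ContinuousOn q (Icc (-R) R)
  cont_p' : ContinuousOn p' (Icc (-R) R)
  cont_q' : ContinuousOn q' (Icc (-R) R)
  cont_Y : ContinuousOn Y (Icc (-R) R)
  deriv_p : ∀ x ∈ Ioo (-R) R, HasDerivAt p (p' x) x
  deriv_q : ∀ x ∈ Ioo (-R) R, HasDerivAt q (q' x) x
  deriv_p' : ∀ x ∈ Ioo (-R) R,
    HasDerivAt p' (V₂ x ^ 2 * p x + 2 * V₁ x * V₂ x * q x + ω ^ 2 * p x - g₁ x) x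
  deriv_q' : ∀ x ∈ Ioo (-R) R,
    HasDerivAt q' (V₁ x ^ 2 * q x + 2 * V₁ x * V₂ x * p x + ω ^ 2 * q x - g₂ x) x
  deriv_Y : ∀ x ∈ Ioo (-R) R, HasDerivAt Y (deriv V₁ x * g₁ x + deriv V₂ x * g₂ x) x
  p_left : p (-R) = 0
  p_right : p R = 0
  q_left : q (-R) = 0
  q_right : q R = 0
  Y_eq : Y (-R) = Y R
  p_le : ∀ x ∈ Icc (-R) R, |p x| ≤ N
  q_le : ∀ x ∈ Icc (-R) R, |q x| ≤ N
  g₁_le : ∀ x ∈ Ioo (-R) R, |g₁ x| ≤ G / Real.cosh (θ * x)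
  g₂_le : ∀ x ∈ Ioo (-R) R, |g₂ x| ≤ G / Real.cosh (θ * x)

lemma div_cosh_le_exp {G : ℝ} (hG : 0 ≤ G) (t : ℝ) :
    G / Real.cosh t ≤ 2 * G * Real.exp (-t) := by
  rw [div_le_iff₀ (Real.cosh_pos t), Real.cosh_eq]
  have : Real.exp (-t) * Real.exp t = 1 := by rw [← Real.exp_add]; simp
  nlinarith [mul_nonneg hG (sq_nonneg (Real.exp (-t)))]

lemma div_cosh_le_div_sq {G : ℝ} (hG : 0 ≤ G) (t : ℝ) :
    G / Real.cosh t ≤ 2 * G / (1 + t ^ 2) := by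
  have h : (1 + t ^ 2) / 2 ≤ Real.cosh t := by
    have h1 : Real.cosh t = Real.cosh (t / 2) ^ 2 + Real.sinh (t / 2) ^ 2 := by
      rw [← Real.cosh_two_mul]; ring_nf
    have h2 : (t / 2) ^ 2 ≤ Real.sinh (t / 2) ^ 2 := by
      rw [sq_le_sq]
      rcases le_total 0 (t / 2) with ht | ht
      · rw [abs_of_nonneg ht]
        exact (Real.self_le_sinh_iff.2 ht).trans (le_abs_self _)
      · rw [abs_of_nonpos ht]
        have := Real.sinh_le_self_iff.2 ht
        exact le_trans (by linarith) (neg_le_abs _)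
    rw [h1, Real.cosh_sq]
    linarith
  calc G / Real.cosh t ≤ G / ((1 + t ^ 2) / 2) := by gcongr
    _ = _ := by field_simp

namespace IsBoundedSolution

lemma neg {V₁ V₂ : ℝ → ℝ} {ω R θ N G : ℝ} {p q p' q' g₁ g₂ Y : ℝ → ℝ}
    (h : IsBoundedSolution V₁ V₂ ω R θ N G p q p' q' g₁ g₂ Y) :
    IsBoundedSolution V₁ V₂ ω R θ N G (fun x => -p x) (fun x => -q x) (fun x => -p' x)
      (fun x => -q' x) (fun x => -g₁ x) (fun x => -g₂ x) (fun x => -Y x) where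
  cont_p := h.cont_p.neg
  cont_q := h.cont_q.neg
  cont_p' := h.cont_p'.neg
  cont_q' := h.cont_q'.neg
  cont_Y := h.cont_Y.neg
  deriv_p x hx := (h.deriv_p x hx).fun_neg
  deriv_q x hx := (h.deriv_q x hx).fun_neg
  deriv_p' x hx := (h.deriv_p' x hx).fun_neg.congr_deriv (by ring)
  deriv_q' x hx := (h.deriv_q' x hx).fun_neg.congr_deriv (by ring)
  deriv_Y x hx := (h.deriv_Y x hx).fun_neg.congr_deriv (by ring)
  p_left := by simp [h.p_left]
  p_right := by simp [h.p_right]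
  q_left := by simp [h.q_left]
  q_right := by simp [h.q_right]
  Y_eq := by simp [h.Y_eq]
  p_le x hx := by simpa using h.p_le x hx
  q_le x hx := by simpa using h.q_le x hx
  g₁_le x hx := by simpa using h.g₁_le x hx
  g₂_le x hx := by simpa using h.g₂_le x hx

/-- The system is invariant under `(p, q) ↦ (q(-x), p(-x))`, because `V₁(-x) = V₂(x)`. -/
lemma reflect {V₁ V₂ : ℝ → ℝ} (hV : IsSegregationProfile V₁ V₂) {ω R θ N G : ℝ}
    {p q p' q' g₁ g₂ Y : ℝ → ℝ}
    (h : IsBoundedSolution V₁ V₂ ω R θ N G p q p' q' g₁ g₂ Y) :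
    IsBoundedSolution V₁ V₂ ω R θ N G (fun x => q (-x)) (fun x => p (-x)) (fun x => -q' (-x))
      (fun x => -p' (-x)) (fun x => g₂ (-x)) (fun x => g₁ (-x)) (fun x => Y (-x)) := by
  have hI : ∀ x ∈ Icc (-R) R, -x ∈ Icc (-R) R := fun x hx =>
    ⟨by linarith [hx.2], by linarith [hx.1]⟩
  have hJ : ∀ x ∈ Ioo (-R) R, -x ∈ Ioo (-R) R := fun x hx =>
    ⟨by linarith [hx.2], by linarith [hx.1]⟩
  have hc : ∀ f : ℝ → ℝ, ContinuousOn f (Icc (-R) R) →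
      ContinuousOn (fun x => f (-x)) (Icc (-R) R) := fun f hf =>
    hf.comp continuous_neg.continuousOn hI
  have hd : ∀ (f : ℝ → ℝ) (d x : ℝ), HasDerivAt f d (-x) →
      HasDerivAt (fun y => f (-y)) (-d) x := fun f d x hf => by
    exact (HasDerivAt.comp x hf (hasDerivAt_neg x)).congr_deriv (by ring)
  refine ⟨hc _ h.cont_q, hc _ h.cont_p, (hc _ h.cont_q').neg, (hc _ h.cont_p').neg, hc _ h.cont_Y,
    fun x hx => hd _ _ _ (h.deriv_q _ (hJ x hx)), fun x hx => hd _ _ _ (h.deriv_p _ (hJ x hx)),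
    fun x hx => ?_, fun x hx => ?_, fun x hx => ?_, ?_, ?_, ?_, ?_, ?_,
    fun x hx => h.q_le _ (hI x hx), fun x hx => h.p_le _ (hI x hx), fun x hx => ?_, fun x hx => ?_⟩
  · refine (hd _ _ _ (h.deriv_q' _ (hJ x hx))).fun_neg.congr_deriv ?_
    rw [hV.symm, hV.symm']; ring
  · refine (hd _ _ _ (h.deriv_p' _ (hJ x hx))).fun_neg.congr_deriv ?_
    rw [hV.symm, hV.symm']; ring
  · refine (hd _ _ _ (h.deriv_Y _ (hJ x hx))).congr_deriv ?_
    rw [hV.deriv_fst_neg, hV.deriv_snd_neg]; ring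
  · simp [h.q_right]
  · simp [h.q_left]
  · simp [h.p_right]
  · simp [h.p_left]
  · simp [h.Y_eq]
  · simpa using h.g₂_le _ (hJ x hx)
  · simpa using h.g₁_le _ (hJ x hx)

lemma nonneg_N {V₁ V₂ : ℝ → ℝ} {ω R θ N G : ℝ} {p q p' q' g₁ g₂ Y : ℝ → ℝ}
    (h : IsBoundedSolution V₁ V₂ ω R θ N G p q p' q' g₁ g₂ Y) (hR : 0 < R) : 0 ≤ N :=
  (abs_nonneg _).trans (h.p_le R ⟨by linarith, le_rfl⟩)

lemma nonneg_G {V₁ V₂ : ℝ → ℝ} {ω R θ N G : ℝ} {p q p' q' g₁ g₂ Y : ℝ → ℝ}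
    (h : IsBoundedSolution V₁ V₂ ω R θ N G p q p' q' g₁ g₂ Y) (hR : 0 < R) : 0 ≤ G := by
  simpa using (abs_nonneg _).trans (h.g₁_le 0 ⟨by linarith, hR⟩)

/-! ### Bounds away from the interface -/

/-- The barrier `(3KN/4)(exp(-2a) - exp(-2x)) + (2G/θ²)(1 - exp(-θx))` controls the component which
sees no potential on the right. -/
lemma le_fst_of_right {V₁ V₂ : ℝ → ℝ} (hV : IsSegregationProfile V₁ V₂) {K : ℝ}
    (hK : ∀ x, 0 ≤ x → V₂ x * V₁ x ^ 2 ≤ K * Real.exp (-2 * x)) {ω R θ N G : ℝ}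
    {p q p' q' g₁ g₂ Y : ℝ → ℝ}
    (h : IsBoundedSolution V₁ V₂ ω R θ N G p q p' q' g₁ g₂ Y) (hθ : 0 < θ) (hω : 0 < ω)
    (hK0 : 0 < K) {a : ℝ} (ha : 0 ≤ a) (haR : a < R) {x : ℝ} (hx : x ∈ Icc a R) :
    p x ≤ |p a| + 2 * G / θ ^ 2 + 3 * K * N * Real.exp (-2 * a) := by
  have hR : 0 < R := by linarith
  have hN := h.nonneg_N hR
  have hG := h.nonneg_G hR
  have hsub : Icc a R ⊆ Icc (-R) R := Icc_subset_Icc_left (by linarith)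
  have hsub' : Ioo a R ⊆ Ioo (-R) R := Ioo_subset_Ioo_left (by linarith)
  have hexp : ∀ (k z : ℝ), HasDerivAt (fun y => Real.exp (-k * y)) (-k * Real.exp (-k * z)) z := by
    intro k z
    simpa [mul_comm] using ((hasDerivAt_id z).const_mul (-k)).exp
  have key := nonneg_of_second_deriv_neg (a := a) (b := R)
    (w := fun y => |p a| + (3 * K * N / 4 * (Real.exp (-2 * a) - Real.exp (-2 * y))
      + 2 * G / θ ^ 2 * (1 - Real.exp (-θ * y))) - p y)
    (w' := fun y => (3 * K * N / 4 * -(-2 * Real.exp (-2 * y))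
      + 2 * G / θ ^ 2 * -(-θ * Real.exp (-θ * y))) - p' y)
    (w'' := fun y => (3 * K * N / 4 * -(-2 * (-2 * Real.exp (-2 * y)))
      + 2 * G / θ ^ 2 * -(-θ * (-θ * Real.exp (-θ * y))))
      - (V₂ y ^ 2 * p y + 2 * V₁ y * V₂ y * q y + ω ^ 2 * p y - g₁ y))
    (by have := h.cont_p.mono hsub; fun_prop)
    (fun y hy => ((((((hexp 2 y).const_sub _).const_mul _).fun_add
      (((hexp θ y).const_sub 1).const_mul _)).const_add _).fun_sub (h.deriv_p y (hsub' hy))))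
    (fun y hy => ((((((hexp 2 y).const_mul _).fun_neg).const_mul _).fun_add
      ((((hexp θ y).const_mul _).fun_neg).const_mul _)).fun_sub (h.deriv_p' y (hsub' hy))))
    ?_ ?_ ?_ x hx
  · have e1 : 2 * G / θ ^ 2 * (1 - Real.exp (-θ * x)) ≤ 2 * G / θ ^ 2 :=
      mul_le_of_le_one_right (by positivity) (by linarith [Real.exp_pos (-θ * x)])
    have e2 : 3 * K * N / 4 * (Real.exp (-2 * a) - Real.exp (-2 * x))
        ≤ 3 * K * N * Real.exp (-2 * a) := by
      have : 0 ≤ K * N := by positivity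
      nlinarith [Real.exp_pos (-2 * a), Real.exp_pos (-2 * x),
        mul_nonneg this (Real.exp_pos (-2 * a)).le, mul_nonneg this (Real.exp_pos (-2 * x)).le]
    linarith
  · have : Real.exp (-θ * a) ≤ 1 := by rw [Real.exp_le_one_iff]; nlinarith
    have : 0 ≤ 2 * G / θ ^ 2 * (1 - Real.exp (-θ * a)) := mul_nonneg (by positivity) (by linarith)
    simp only [sub_self, mul_zero, zero_add]
    linarith [le_abs_self (p a)]
  · have : Real.exp (-θ * R) ≤ 1 := by rw [Real.exp_le_one_iff]; nlinarith
    have : 0 ≤ 2 * G / θ ^ 2 * (1 - Real.exp (-θ * R)) := mul_nonneg (by positivity) (by linarith)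
    have e : Real.exp (-2 * R) ≤ Real.exp (-2 * a) := by rw [Real.exp_le_exp]; linarith
    have : 0 ≤ 3 * K * N / 4 * (Real.exp (-2 * a) - Real.exp (-2 * R)) :=
      mul_nonneg (by positivity) (by linarith)
    simp only [h.p_right]
    linarith [abs_nonneg (p a)]
  · intro y hy hneg
    have hy0 : 0 ≤ y := by linarith [hy.1]
    obtain ⟨b1, b2, -⟩ := hV.interaction_bounds hK hy0
    have hg : g₁ y ≤ 2 * G * Real.exp (-θ * y) := by
      rw [neg_mul]
      exact (le_abs_self _).trans ((h.g₁_le y (hsub' hy)).trans (div_cosh_le_exp hG _))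
    have hp : 0 < p y := by
      have e1 : Real.exp (-θ * y) ≤ 1 := by rw [Real.exp_le_one_iff]; nlinarith
      have e2 : 0 ≤ 2 * G / θ ^ 2 * (1 - Real.exp (-θ * y)) :=
        mul_nonneg (by positivity) (by linarith)
      have e3 : Real.exp (-2 * y) ≤ Real.exp (-2 * a) := by rw [Real.exp_le_exp]; linarith [hy.1]
      have e4 : 0 ≤ 3 * K * N / 4 * (Real.exp (-2 * a) - Real.exp (-2 * y)) :=
        mul_nonneg (by positivity) (by linarith)
      have e5 := abs_nonneg (p a)
      linarith
    have hq := abs_le.1 (h.q_le y (hsub (Ioo_subset_Icc_self hy)))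
    have v1 := hV.pos_fst y
    have v2 := hV.pos_snd y
    have hq' : -(2 * V₁ y * V₂ y * q y) ≤ 2 * (K * Real.exp (-2 * y)) * N := by
      have : 0 < V₁ y * V₂ y := by positivity
      nlinarith [hq.1]
    have c1 : 2 * G / θ ^ 2 * -(-θ * (-θ * Real.exp (-θ * y))) = -(2 * G * Real.exp (-θ * y)) := by
      field_simp
    have c2 : 0 ≤ V₂ y ^ 2 * p y := by positivity
    have c3 : 0 < ω ^ 2 * p y := by positivity
    have c4 : 0 ≤ K * N * Real.exp (-2 * y) := by positivity
    simp only [c1]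
    nlinarith

/-- The component which sees the potential `V₁² ≥ 1` is controlled by comparison with a
constant. -/
lemma le_snd_of_right {V₁ V₂ : ℝ → ℝ} (hV : IsSegregationProfile V₁ V₂) {K : ℝ}
    (hK : ∀ x, 0 ≤ x → V₂ x * V₁ x ^ 2 ≤ K * Real.exp (-2 * x)) {ω R θ N G : ℝ}
    {p q p' q' g₁ g₂ Y : ℝ → ℝ}
    (h : IsBoundedSolution V₁ V₂ ω R θ N G p q p' q' g₁ g₂ Y) (hω : 0 < ω)
    (hK0 : 0 < K) {a : ℝ} (ha : 0 ≤ a) (haR : a < R) {x : ℝ} (hx : x ∈ Icc a R) :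
    q x ≤ |q a| + G + 2 * K * N * Real.exp (-2 * a) := by
  have hR : 0 < R := by linarith
  have hN := h.nonneg_N hR
  have hG := h.nonneg_G hR
  have hsub : Icc a R ⊆ Icc (-R) R := Icc_subset_Icc_left (by linarith)
  have hsub' : Ioo a R ⊆ Ioo (-R) R := Ioo_subset_Ioo_left (by linarith)
  have hc0 : 0 ≤ 2 * K * N * Real.exp (-2 * a) := by positivity
  have key := nonneg_of_second_deriv_neg (a := a) (b := R)
    (w := fun y => |q a| + G + 2 * K * N * Real.exp (-2 * a) - q y)
    (w' := fun y => -q' y)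
    (w'' := fun y => -(V₁ y ^ 2 * q y + 2 * V₁ y * V₂ y * p y + ω ^ 2 * q y - g₂ y))
    (by have := h.cont_q.mono hsub; fun_prop)
    (fun y hy => (h.deriv_q y (hsub' hy)).const_sub _)
    (fun y hy => (h.deriv_q' y (hsub' hy)).fun_neg)
    (by linarith [le_abs_self (q a)])
    (by simp only [h.q_right]; linarith [abs_nonneg (q a)]) ?_ x hx
  · linarith
  · intro y hy hneg
    have hy0 : 0 ≤ y := by linarith [hy.1]
    obtain ⟨-, b2, -⟩ := hV.interaction_bounds hK hy0
    have hg : g₂ y ≤ G := (le_abs_self _).trans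
      ((h.g₂_le y (hsub' hy)).trans (div_le_self hG (Real.one_le_cosh _)))
    have hp := abs_le.1 (h.p_le y (hsub (Ioo_subset_Icc_self hy)))
    have v1 := hV.one_le_fst hy0
    have v2 := hV.pos_snd y
    have e : Real.exp (-2 * y) ≤ Real.exp (-2 * a) := by rw [Real.exp_le_exp]; linarith [hy.1]
    have hp' : -(2 * V₁ y * V₂ y * p y) ≤ 2 * K * N * Real.exp (-2 * a) := by
      have h0 : 0 < V₁ y * V₂ y := by positivity
      have h1 : V₁ y * V₂ y ≤ K * Real.exp (-2 * a) := b2.trans (by gcongr)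
      nlinarith [hp.1]
    have hq : 0 < q y := by linarith [abs_nonneg (q a)]
    have c2 : q y ≤ V₁ y ^ 2 * q y := le_mul_of_one_le_left hq.le (by nlinarith)
    have c3 : 0 < ω ^ 2 * q y := by positivity
    linarith [abs_nonneg (q a)]

/-- A bound on `[-a, a]` extends to `[-R, R]`, up to a multiple of `G` and a small multiple
of `N`. -/
lemma abs_le_of_inner {V₁ V₂ : ℝ → ℝ} (hV : IsSegregationProfile V₁ V₂) {K : ℝ}
    (hK : ∀ x, 0 ≤ x → V₂ x * V₁ x ^ 2 ≤ K * Real.exp (-2 * x)) {ω R θ N G : ℝ}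
    {p q p' q' g₁ g₂ Y : ℝ → ℝ}
    (h : IsBoundedSolution V₁ V₂ ω R θ N G p q p' q' g₁ g₂ Y) (hθ : 0 < θ) (hω : 0 < ω)
    (hK0 : 0 < K) {a : ℝ} (ha : 0 ≤ a) (haR : a < R) {D : ℝ}
    (hD : ∀ x ∈ Icc (-a) a, |p x| ≤ D ∧ |q x| ≤ D) {x : ℝ} (hx : x ∈ Icc (-R) R) :
    |p x| ≤ D + (1 + 2 / θ ^ 2) * G + 3 * K * N * Real.exp (-2 * a) ∧
      |q x| ≤ D + (1 + 2 / θ ^ 2) * G + 3 * K * N * Real.exp (-2 * a) := by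
  have hR : 0 < R := by linarith
  have hN := h.nonneg_N hR
  have hG := h.nonneg_G hR
  -- the bound on the right of `a`, stated for an arbitrary solution so as to apply to reflections
  have right : ∀ {p q p' q' g₁ g₂ Y : ℝ → ℝ},
      IsBoundedSolution V₁ V₂ ω R θ N G p q p' q' g₁ g₂ Y → |p a| ≤ D → |q a| ≤ D →
      ∀ x ∈ Icc a R, |p x| ≤ D + (1 + 2 / θ ^ 2) * G + 3 * K * N * Real.exp (-2 * a) ∧
        |q x| ≤ D + (1 + 2 / θ ^ 2) * G + 3 * K * N * Real.exp (-2 * a) := by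
    intro p q p' q' g₁ g₂ Y h hp hq x hx
    have a1 := h.le_fst_of_right hV hK hθ hω hK0 ha haR hx
    have a2 := h.neg.le_fst_of_right hV hK hθ hω hK0 ha haR hx
    have a3 := h.le_snd_of_right hV hK hω hK0 ha haR hx
    have a4 := h.neg.le_snd_of_right hV hK hω hK0 ha haR hx
    rw [abs_neg] at a2 a4
    have e : (1 + 2 / θ ^ 2) * G = G + 2 * G / θ ^ 2 := by ring
    have e1 : 0 ≤ 2 * G / θ ^ 2 := by positivity
    have e2 : 0 ≤ K * N * Real.exp (-2 * a) := by positivity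
    rw [e]
    exact ⟨abs_le.2 ⟨by linarith, by linarith⟩, abs_le.2 ⟨by linarith, by linarith⟩⟩
  have haa : a ∈ Icc (-a) a := ⟨by linarith, le_rfl⟩
  have haa' : -a ∈ Icc (-a) a := ⟨le_rfl, by linarith⟩
  rcases le_total a x with hxa | hxa
  · exact right h (hD a haa).1 (hD a haa).2 x ⟨hxa, hx.2⟩
  rcases le_total x (-a) with hxa' | hxa'
  · have := right (h.reflect hV) (hD (-a) haa').2 (hD (-a) haa').1 (-x)
      ⟨by linarith, by linarith [hx.1]⟩
    rw [neg_neg] at this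
    exact this.symm
  · have e2 : 0 ≤ 3 * K * N * Real.exp (-2 * a) := by positivity
    have e1 : 0 ≤ (1 + 2 / θ ^ 2) * G := by positivity
    obtain ⟨h1, h2⟩ := hD x ⟨hxa', hxa⟩
    constructor <;> linarith

end IsBoundedSolution

/-! ### Picone's identity and the energy estimate -/

lemma abs_le_mul_sq_add {t : ℝ} (ht : 0 < t) (z : ℝ) : |z| ≤ t * z ^ 2 + 1 / (4 * t) := by
  have : t * z ^ 2 + 1 / (4 * t) - |z| = (2 * t * |z| - 1) ^ 2 / (4 * t) := by
    rw [← sq_abs z]; field_simp; ring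
  have : 0 ≤ (2 * t * |z| - 1) ^ 2 / (4 * t) := by positivity
  linarith

namespace IsBoundedSolution

/-- Picone's identity for the positive solution `(V₁', -V₂')` of the linearized system at `ω = 0`. -/
lemma hasDerivAt_picone {V₁ V₂ : ℝ → ℝ} (hV : IsSegregationProfile V₁ V₂) {ω R θ N G : ℝ}
    {p q p' q' g₁ g₂ Y : ℝ → ℝ}
    (h : IsBoundedSolution V₁ V₂ ω R θ N G p q p' q' g₁ g₂ Y) {x : ℝ} (hx : x ∈ Ioo (-R) R) :
    HasDerivAt (fun y => p y * p' y - p y ^ 2 * ((V₁ y * V₂ y ^ 2) / deriv V₁ y)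
        + (q y * q' y - q y ^ 2 * ((V₂ y * V₁ y ^ 2) / deriv V₂ y)))
      ((p' x - p x * (V₁ x * V₂ x ^ 2) / deriv V₁ x) ^ 2
        + (q' x - q x * (V₂ x * V₁ x ^ 2) / deriv V₂ x) ^ 2
        + 2 * V₁ x * V₂ x * deriv V₁ x * -deriv V₂ x
          * (p x / deriv V₁ x - q x / deriv V₂ x) ^ 2
        + ω ^ 2 * (p x ^ 2 + q x ^ 2) - p x * g₁ x - q x * g₂ x) x := by
  have d1 := (hV.deriv_pos x).ne'
  have d2 := (hV.deriv_snd_lt_zero x).ne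
  have v1 := hV.hasDerivAt_fst x
  have v2 := hV.hasDerivAt_snd x
  have hp := h.deriv_p x hx
  have hq := h.deriv_q x hx
  have key := ((hp.fun_mul (h.deriv_p' x hx)).fun_sub ((hp.fun_pow 2).fun_mul
      ((v1.fun_mul (v2.fun_pow 2)).fun_div (hV.hasDerivAt_deriv_fst x) d1))).fun_add
    ((hq.fun_mul (h.deriv_q' x hx)).fun_sub ((hq.fun_pow 2).fun_mul
      ((v2.fun_mul (v1.fun_pow 2)).fun_div (hV.hasDerivAt_deriv_snd x) d2)))
  refine key.congr_deriv ?_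
  simp only [Nat.cast_ofNat, Nat.reduceSub, pow_one]
  field_simp
  ring

lemma hasDerivAt_div_deriv_fst {V₁ V₂ : ℝ → ℝ} (hV : IsSegregationProfile V₁ V₂)
    {ω R θ N G : ℝ} {p q p' q' g₁ g₂ Y : ℝ → ℝ}
    (h : IsBoundedSolution V₁ V₂ ω R θ N G p q p' q' g₁ g₂ Y) {x : ℝ} (hx : x ∈ Ioo (-R) R) :
    HasDerivAt (fun y => p y / deriv V₁ y)
      ((p' x - p x * (V₁ x * V₂ x ^ 2) / deriv V₁ x) / deriv V₁ x) x := by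
  have d1 := (hV.deriv_pos x).ne'
  refine ((h.deriv_p x hx).fun_div (hV.hasDerivAt_deriv_fst x) d1).congr_deriv ?_
  field_simp

lemma hasDerivAt_div_deriv_snd {V₁ V₂ : ℝ → ℝ} (hV : IsSegregationProfile V₁ V₂)
    {ω R θ N G : ℝ} {p q p' q' g₁ g₂ Y : ℝ → ℝ}
    (h : IsBoundedSolution V₁ V₂ ω R θ N G p q p' q' g₁ g₂ Y) {x : ℝ} (hx : x ∈ Ioo (-R) R) :
    HasDerivAt (fun y => q y / deriv V₂ y)
      ((q' x - q x * (V₂ x * V₁ x ^ 2) / deriv V₂ x) / deriv V₂ x) x := by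
  have d1 := (hV.deriv_snd_lt_zero x).ne
  refine ((h.deriv_q x hx).fun_div (hV.hasDerivAt_deriv_snd x) d1).congr_deriv ?_
  field_simp

/-- The energy density in Picone's identity is dominated by the derivative of a function `H` whose
total increase is at most `4πNG/θ`: the Picone flux, which vanishes at `±R`, plus a primitive of a
bound for `p g₁ + q g₂`. -/
lemma exists_energy {V₁ V₂ : ℝ → ℝ} (hV : IsSegregationProfile V₁ V₂) {ω R θ N G : ℝ}
    {p q p' q' g₁ g₂ Y : ℝ → ℝ}
    (h : IsBoundedSolution V₁ V₂ ω R θ N G p q p' q' g₁ g₂ Y) (hθ : 0 < θ) (hR : 0 < R) :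
    ∃ H H' : ℝ → ℝ, ContinuousOn H (Icc (-R) R) ∧
      (∀ x ∈ Ioo (-R) R, HasDerivAt H (H' x) x ∧
        (p' x - p x * (V₁ x * V₂ x ^ 2) / deriv V₁ x) ^ 2
          + (q' x - q x * (V₂ x * V₁ x ^ 2) / deriv V₂ x) ^ 2
          + 2 * V₁ x * V₂ x * deriv V₁ x * -deriv V₂ x
            * (p x / deriv V₁ x - q x / deriv V₂ x) ^ 2 ≤ H' x) ∧
      ∀ x ∈ Icc (-R) R, ∀ y ∈ Icc (-R) R, x ≤ y → H y - H x ≤ 4 * Real.pi * N * G / θ := by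
  have hN := h.nonneg_N hR
  have hG := h.nonneg_G hR
  set H : ℝ → ℝ := fun y => (p y * p' y - p y ^ 2 * ((V₁ y * V₂ y ^ 2) / deriv V₁ y)
    + (q y * q' y - q y ^ 2 * ((V₂ y * V₁ y ^ 2) / deriv V₂ y)))
    + 4 * N * G / θ * Real.arctan (θ * y) with hH
  set S : ℝ → ℝ := fun x => (p' x - p x * (V₁ x * V₂ x ^ 2) / deriv V₁ x) ^ 2
    + (q' x - q x * (V₂ x * V₁ x ^ 2) / deriv V₂ x) ^ 2
    + 2 * V₁ x * V₂ x * deriv V₁ x * -deriv V₂ x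
      * (p x / deriv V₁ x - q x / deriv V₂ x) ^ 2 with hS
  set H' : ℝ → ℝ := fun x => (S x + ω ^ 2 * (p x ^ 2 + q x ^ 2) - p x * g₁ x - q x * g₂ x)
    + 4 * N * G / θ * (1 / (1 + (θ * x) ^ 2) * (θ * 1)) with hH'
  have hcont : ContinuousOn H (Icc (-R) R) := by
    have c1 := h.cont_p
    have c2 := h.cont_q
    have c3 := h.cont_p'
    have c4 := h.cont_q'
    have c5 : Continuous V₁ := hV.contDiff_fst.continuous
    have c6 : Continuous V₂ := hV.contDiff_snd.continuous
    have c7 : Continuous fun y => V₁ y * V₂ y ^ 2 / deriv V₁ y :=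
      (by fun_prop : Continuous fun y => V₁ y * V₂ y ^ 2).div
        (hV.contDiff_fst.continuous_deriv (by norm_num)) fun y => (hV.deriv_pos y).ne'
    have c8 : Continuous fun y => V₂ y * V₁ y ^ 2 / deriv V₂ y :=
      (by fun_prop : Continuous fun y => V₂ y * V₁ y ^ 2).div
        (hV.contDiff_snd.continuous_deriv (by norm_num)) fun y => (hV.deriv_snd_lt_zero y).ne
    have c9 : Continuous fun y => Real.arctan (θ * y) :=
      Real.continuous_arctan.comp (by fun_prop)
    exact ((((c1.mul c3).sub ((c1.pow 2).mul c7.continuousOn)).add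
      ((c2.mul c4).sub ((c2.pow 2).mul c8.continuousOn)))).add (continuousOn_const.mul c9.continuousOn)
  have hder : ∀ x ∈ Ioo (-R) R, HasDerivAt H (H' x) x := fun x hx =>
    (h.hasDerivAt_picone hV hx).fun_add ((((hasDerivAt_id x).const_mul θ).arctan).const_mul _)
  have hS0 : ∀ x, 0 ≤ S x := fun x => by
    have v1 := hV.pos_fst x
    have v2 := hV.pos_snd x
    have d1 := hV.deriv_pos x
    have d2 : 0 < -deriv V₂ x := by linarith [hV.deriv_snd_lt_zero x]
    positivity
  have hle : ∀ x ∈ Ioo (-R) R, S x ≤ H' x := by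
    intro x hx
    have hx' := Ioo_subset_Icc_self hx
    have b : ∀ u g : ℝ, |u| ≤ N → |g| ≤ G / Real.cosh (θ * x) →
        u * g ≤ N * (2 * G / (1 + (θ * x) ^ 2)) := fun u g hu hg =>
      calc u * g ≤ |u| * |g| := by rw [← abs_mul]; exact le_abs_self _
        _ ≤ N * (2 * G / (1 + (θ * x) ^ 2)) :=
          mul_le_mul hu (hg.trans (div_cosh_le_div_sq hG _)) (abs_nonneg _) hN
    have b1 := b _ _ (h.p_le x hx') (h.g₁_le x hx)
    have b2 := b _ _ (h.q_le x hx') (h.g₂_le x hx)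
    have e : 4 * N * G / θ * (1 / (1 + (θ * x) ^ 2) * (θ * 1))
        = 2 * (N * (2 * G / (1 + (θ * x) ^ 2))) := by
      field_simp; ring
    have : 0 ≤ ω ^ 2 * (p x ^ 2 + q x ^ 2) := by positivity
    simp only [hH', e]
    linarith
  have hmono : ∀ x ∈ Icc (-R) R, ∀ y ∈ Icc (-R) R, x ≤ y → H x ≤ H y := by
    intro x hx y hy hxy
    refine le_of_hasDerivAt_nonneg hxy (hcont.mono (Icc_subset_Icc hx.1 hy.2))
      (fun z hz => hder z (Ioo_subset_Ioo hx.1 hy.2 hz))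
      (fun z hz => (hS0 z).trans (hle z (Ioo_subset_Ioo hx.1 hy.2 hz)))
  refine ⟨H, H', hcont, fun x hx => ⟨hder x hx, hle x hx⟩, fun x hx y hy hxy => ?_⟩
  have hl : -R ∈ Icc (-R) R := ⟨le_rfl, by linarith⟩
  have hr : R ∈ Icc (-R) R := ⟨by linarith, le_rfl⟩
  have h1 := hmono _ hl x hx hx.1
  have h2 := hmono y hy _ hr hy.2
  have h3 : H R ≤ 4 * N * G / θ * (Real.pi / 2) := by
    simp only [hH, h.p_right, h.q_right]
    have := Real.arctan_lt_pi_div_two (θ * R)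
    have : 4 * N * G / θ * Real.arctan (θ * R) ≤ 4 * N * G / θ * (Real.pi / 2) := by gcongr
    linarith
  have h4 : -(4 * N * G / θ * (Real.pi / 2)) ≤ H (-R) := by
    simp only [hH, h.p_left, h.q_left]
    have := Real.neg_pi_div_two_lt_arctan (θ * -R)
    have : 4 * N * G / θ * -(Real.pi / 2) ≤ 4 * N * G / θ * Real.arctan (θ * -R) := by gcongr
    linarith
  have e : 4 * Real.pi * N * G / θ = 2 * (4 * N * G / θ * (Real.pi / 2)) := by ring
  linarith

/-- On a fixed interval `[-a, a]` the solution is close to a multiple of `(V₁', V₂')`, quantitatively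
in `√(NG)`, the square root being linearized with the free parameter `t`. -/
lemma exists_near_kernel {V₁ V₂ : ℝ → ℝ} (hV : IsSegregationProfile V₁ V₂) {M : ℝ}
    (hM : ∀ x, deriv V₁ x ≤ M) {θ : ℝ} (hθ : 0 < θ) {a : ℝ} (ha : 1 ≤ a) :
    ∃ B : ℝ, 0 < B ∧ ∀ {ω R N G : ℝ} {p q p' q' g₁ g₂ Y : ℝ → ℝ},
      IsBoundedSolution V₁ V₂ ω R θ N G p q p' q' g₁ g₂ Y → a < R → ∀ t : ℝ, 0 < t →
      ∃ c : ℝ, ∀ x ∈ Icc (-a) a,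
        |p x - c * deriv V₁ x| ≤ B * (t * (N * G) + 1 / t) ∧
        |q x - c * deriv V₂ x| ≤ B * (t * (N * G) + 1 / t) := by
  have hM0 : 0 < M := (hV.deriv_pos 0).trans_le (hM 0)
  set m : ℝ := min (V₁ (-a)) (deriv V₁ (-a)) with hm
  have hm0 : 0 < m := lt_min (hV.pos_fst _) (hV.deriv_pos _)
  have hm1 : ∀ x ∈ Icc (-a) a, m ≤ V₁ x ∧ m ≤ V₂ x ∧ m ≤ deriv V₁ x ∧ m ≤ -deriv V₂ x := by
    intro x hx
    refine ⟨(min_le_left _ _).trans (hV.monotone_fst hx.1), ?_,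
      (min_le_right _ _).trans (hV.monotone_deriv_fst hx.1), ?_⟩
    · rw [← hV.symm]
      exact (min_le_left _ _).trans (hV.monotone_fst (by linarith [hx.2]))
    · rw [hV.deriv_snd, neg_neg]
      exact (min_le_right _ _).trans (hV.monotone_deriv_fst (by linarith [hx.2]))
  set P : ℝ := 4 * Real.pi / θ with hP
  have hP0 : 0 < P := by have := Real.pi_pos; positivity
  refine ⟨M * (2 * P / m ^ 2 + P / (2 * m ^ 4) + a + 1), by positivity, ?_⟩
  intro ω R N G p q p' q' g₁ g₂ Y h haR t ht
  have hR : 0 < R := by linarith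
  have hN := h.nonneg_N hR
  have hG := h.nonneg_G hR
  obtain ⟨H, H', hHc, hH, hE⟩ := h.exists_energy hV hθ hR
  set E := 4 * Real.pi * N * G / θ with hEdef
  have hEP : E = P * (N * G) := by rw [hEdef, hP]; ring
  have hE0 : 0 ≤ E := by rw [hEP]; positivity
  set u : ℝ → ℝ := fun y => p y / deriv V₁ y with hu
  set v : ℝ → ℝ := fun y => q y / deriv V₂ y with hv
  have hsub : Icc (-a) a ⊆ Icc (-R) R := Icc_subset_Icc (by linarith) haR.le
  have hsub' : Icc (-a) a ⊆ Ioo (-R) R := fun x hx => ⟨by linarith [hx.1], by linarith [hx.2]⟩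
  have hud := fun x hx => h.hasDerivAt_div_deriv_fst hV (x := x) (hsub' hx)
  have hvd := fun x hx => h.hasDerivAt_div_deriv_snd hV (x := x) (hsub' hx)
  -- the energy density dominates each of its three nonnegative terms
  have hterm : ∀ x ∈ Icc (-a) a,
      (p' x - p x * (V₁ x * V₂ x ^ 2) / deriv V₁ x) ^ 2 ≤ H' x ∧
      (q' x - q x * (V₂ x * V₁ x ^ 2) / deriv V₂ x) ^ 2 ≤ H' x ∧
      2 * m ^ 4 * (u x - v x) ^ 2 ≤ H' x := by
    intro x hx
    obtain ⟨k1, k2, k3, k4⟩ := hm1 x hx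
    have hs := (hH x (hsub' hx)).2
    have e : 2 * m ^ 4 ≤ 2 * V₁ x * V₂ x * deriv V₁ x * -deriv V₂ x := by
      calc 2 * m ^ 4 = 2 * m * m * m * m := by ring
        _ ≤ _ := by
          have := hm0.le.trans k1
          have := hm0.le.trans k2
          have := hm0.le.trans k3
          gcongr
    have e2 := mul_le_mul_of_nonneg_right e (sq_nonneg (u x - v x))
    have e3 := mul_nonneg (by positivity : 0 ≤ 2 * m ^ 4) (sq_nonneg (u x - v x))
    have s1 := sq_nonneg (p' x - p x * (V₁ x * V₂ x ^ 2) / deriv V₁ x)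
    have s2 := sq_nonneg (q' x - q x * (V₂ x * V₁ x ^ 2) / deriv V₂ x)
    simp only [hu, hv] at e2 e3 ⊢
    refine ⟨by linarith, by linarith, by linarith⟩
  have osc : ∀ (f α d : ℝ → ℝ), (∀ x ∈ Icc (-a) a, HasDerivAt f (α x / d x) x) →
      (∀ x ∈ Icc (-a) a, m ≤ |d x|) → (∀ x ∈ Icc (-a) a, α x ^ 2 ≤ H' x) →
      ∀ x ∈ Icc (-a) a, ∀ y ∈ Icc (-a) a, |f y - f x| ≤ t / m ^ 2 * E + a / (2 * t) := by
    intro f α d hf hd hα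
    have main : ∀ x ∈ Icc (-a) a, ∀ y ∈ Icc (-a) a, x ≤ y →
        |f y - f x| ≤ t / m ^ 2 * E + a / (2 * t) := by
      intro x hx y hy hxy
      have hI : Icc x y ⊆ Icc (-a) a := Icc_subset_Icc hx.1 hy.2
      have hI' : Ioo x y ⊆ Icc (-a) a := Ioo_subset_Icc_self.trans hI
      have key := abs_sub_le_of_abs_deriv_le hxy (f := f) (f' := fun z => α z / d z)
        (b := fun z => t / m ^ 2 * H z + 1 / (4 * t) * z)
        (b' := fun z => t / m ^ 2 * H' z + 1 / (4 * t) * 1)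
        (fun z hz => (hf z (hI hz)).continuousAt.continuousWithinAt)
        (by have := hHc.mono (hI.trans hsub); fun_prop)
        (fun z hz => hf z (hI' hz))
        (fun z hz => ((hH z (hsub' (hI' hz))).1.const_mul _).fun_add
          ((hasDerivAt_id z).const_mul _)) ?_
      · have e1 := mul_le_mul_of_nonneg_left (hE x (hsub hx) y (hsub hy) hxy)
          (by positivity : 0 ≤ t / m ^ 2)
        have e2 : 1 / (4 * t) * (y - x) ≤ 1 / (4 * t) * (2 * a) := by
          gcongr; linarith [hx.1, hy.2]
        have e3 : 1 / (4 * t) * (2 * a) = a / (2 * t) := by field_simp; ring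
        linarith
      · intro z hz
        have hz' := hI' hz
        have hd0 : 0 < |d z| := hm0.trans_le (hd z hz')
        have e1 : (α z / d z) ^ 2 ≤ H' z / m ^ 2 := by
          rw [div_pow, ← sq_abs (d z)]
          have := hα z hz'
          have := hd z hz'
          gcongr
          exact (sq_nonneg _).trans (hα z hz')
        calc |α z / d z| ≤ t * (α z / d z) ^ 2 + 1 / (4 * t) := abs_le_mul_sq_add ht _
          _ ≤ t * (H' z / m ^ 2) + 1 / (4 * t) := by gcongr
          _ = _ := by ring
    intro x hx y hy
    rcases le_total x y with hxy | hxy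
    · exact main x hx y hy hxy
    · rw [abs_sub_comm]; exact main y hy x hx hxy
  have oscu := osc u _ (deriv V₁) hud (fun x hx => (hm1 x hx).2.2.1.trans (le_abs_self _))
    (fun x hx => (hterm x hx).1)
  have oscv := osc v _ (deriv V₂) hvd (fun x hx => (hm1 x hx).2.2.2.trans (neg_le_abs _))
    (fun x hx => (hterm x hx).2.1)
  have h01 : Icc (0 : ℝ) 1 ⊆ Icc (-a) a := Icc_subset_Icc (by linarith) ha
  -- at some point the energy density is at most its mean, which brings `u` and `v` together there
  obtain ⟨ξ, hξ, hs⟩ := exists_hasDerivAt_eq_slope H H' (zero_lt_one (α := ℝ))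
    (hHc.mono (h01.trans hsub)) (fun z hz => (hH z (hsub' (h01 (Ioo_subset_Icc_self hz)))).1)
  have hξ' : ξ ∈ Icc (-a) a := h01 (Ioo_subset_Icc_self hξ)
  have h0 : (0 : ℝ) ∈ Icc (-a) a := h01 ⟨le_rfl, zero_le_one⟩
  have huv : |u ξ - v ξ| ≤ t * (E / (2 * m ^ 4)) + 1 / (4 * t) := by
    have e1 : 2 * m ^ 4 * (u ξ - v ξ) ^ 2 ≤ E := by
      refine (hterm ξ hξ').2.2.trans ?_
      rw [hs, sub_zero, div_one]
      exact hE 0 (hsub h0) 1 (hsub (h01 ⟨zero_le_one, le_rfl⟩)) zero_le_one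
    have e2 : (u ξ - v ξ) ^ 2 ≤ E / (2 * m ^ 4) := by
      rw [le_div_iff₀ (by positivity)]; linarith
    exact (abs_le_mul_sq_add ht _).trans (by gcongr)
  set δ := 2 * (t / m ^ 2 * E + a / (2 * t)) + (t * (E / (2 * m ^ 4)) + 1 / (4 * t)) with hδ
  have hδle : M * δ ≤ M * (2 * P / m ^ 2 + P / (2 * m ^ 4) + a + 1) * (t * (N * G) + 1 / t) := by
    rw [mul_assoc]
    refine mul_le_mul_of_nonneg_left ?_ hM0.le
    have e : (2 * P / m ^ 2 + P / (2 * m ^ 4) + a + 1) * (t * (N * G) + 1 / t) - δ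
        = (a + 1) * (t * (N * G)) + (2 * P / m ^ 2 + P / (2 * m ^ 4) + 3 / 4) * (1 / t) := by
      rw [hδ, hEP]; field_simp; ring
    have : 0 ≤ (a + 1) * (t * (N * G)) + (2 * P / m ^ 2 + P / (2 * m ^ 4) + 3 / 4) * (1 / t) := by
      positivity
    linarith
  have hs0 : 0 ≤ t * (E / (2 * m ^ 4)) + 1 / (4 * t) := by positivity
  have hs1 : 0 ≤ t / m ^ 2 * E + a / (2 * t) := by positivity
  refine ⟨u 0, fun x hx => ⟨?_, ?_⟩⟩
  · have e1 : |u x - u 0| ≤ δ := by have := oscu 0 h0 x hx; linarith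
    have e2 : p x - u 0 * deriv V₁ x = (u x - u 0) * deriv V₁ x := by
      simp only [hu]; have := (hV.deriv_pos x).ne'; field_simp
    rw [e2, abs_mul, mul_comm]
    exact (mul_le_mul (hV.abs_deriv_fst_le hM x) e1 (abs_nonneg _) hM0.le).trans hδle
  · have e1 : |v x - u 0| ≤ δ := by
      have a1 := abs_le.1 (oscv ξ hξ' x hx)
      have a2 := abs_le.1 (oscu 0 h0 ξ hξ')
      have a3 := abs_le.1 huv
      exact abs_le.2 ⟨by linarith [a1.1, a2.1, a3.2], by linarith [a1.2, a2.2, a3.1]⟩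
    have e2 : q x - u 0 * deriv V₂ x = (v x - u 0) * deriv V₂ x := by
      simp only [hv]; have := (hV.deriv_snd_lt_zero x).ne; field_simp
    rw [e2, abs_mul, mul_comm]
    exact (mul_le_mul (hV.abs_deriv_snd_le hM x) e1 (abs_nonneg _) hM0.le).trans hδle

end IsBoundedSolution

/-! ### The solvability condition -/

lemma cosh_div_sinh_bounds {z : ℝ} (hz : 1 ≤ z) :
    1 ≤ Real.cosh z / Real.sinh z ∧ Real.cosh z / Real.sinh z ≤ 2 := by
  have hs : 0 < Real.sinh z := Real.sinh_pos_iff.2 (by linarith)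
  rw [one_le_div hs, div_le_iff₀ hs]
  refine ⟨(Real.sinh_lt_cosh z).le, ?_⟩
  rw [Real.cosh_eq, Real.sinh_eq]
  have h1 : 3 ≤ Real.exp z * Real.exp z := by
    rw [← Real.exp_add]; linarith [Real.add_one_le_exp (z + z)]
  have h2 : Real.exp z * Real.exp (-z) = 1 := by rw [← Real.exp_add]; simp
  nlinarith [Real.exp_pos (-z), Real.exp_pos z]

lemma mul_exp_neg_le {s : ℝ} (hs : 0 < s) (x : ℝ) :
    x * Real.exp (-(2 * s) * x) ≤ 1 / s * Real.exp (-s * x) := by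
  have h1 := Real.add_one_le_exp (s * x)
  have h2 : Real.exp (-s * x) = Real.exp (s * x) * Real.exp (-(2 * s) * x) := by
    rw [← Real.exp_add]; ring_nf
  rw [h2, ← mul_assoc]
  refine mul_le_mul_of_nonneg_right ?_ (Real.exp_pos _).le
  rw [div_mul_eq_mul_div, le_div_iff₀ hs]
  linarith

namespace IsBoundedSolution

/-- Testing the equation on `[0, R]` with `e V'`, where `e(x) = sinh (ω (R - x)) / sinh (ω R)` solves
`e'' = ω² e`, `e(0) = 1`, `e(R) = 0`. What remains of the operator is the term `-2 e' V''`, which is of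
order `ω` and localized near the interface, where the solution is close to `c V'`; the integral of
`V'' · V'` over `[0, a]` is then explicit. The terms at `0` cancel against those of the reflected
solution. -/
lemma half_line_identity {V₁ V₂ : ℝ → ℝ} (hV : IsSegregationProfile V₁ V₂) {M K : ℝ}
    (hM : ∀ x, deriv V₁ x ≤ M)
    (hK : ∀ x, 0 ≤ x → V₂ x * V₁ x ^ 2 ≤ K * Real.exp (-2 * x)) (hK0 : 0 < K)
    {ω R θ N G : ℝ} {p q p' q' g₁ g₂ Y : ℝ → ℝ}
    (h : IsBoundedSolution V₁ V₂ ω R θ N G p q p' q' g₁ g₂ Y) (hθ : 0 < θ) (hω : 0 < ω)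
    (hωR : 1 ≤ ω * R) {a : ℝ} (ha : 0 ≤ a) (haR : a < R) {c ε : ℝ}
    (hc : ∀ x ∈ Icc 0 a, |p x - c * deriv V₁ x| ≤ ε ∧ |q x - c * deriv V₂ x| ≤ ε) :
    |Y R - Y 0 - (deriv V₁ 0 * p' 0 + deriv V₂ 0 * q' 0 - (p 0 + q 0))
        - ω * (Real.cosh (ω * R) / Real.sinh (ω * R)) * c * (deriv V₁ a ^ 2 + deriv V₂ a ^ 2)|
      ≤ ω * (64 * M / θ ^ 2 * G + (8 * K + 4 * M) * ε + 4 * ω * K * M * |c|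
        + 4 * K * N * Real.exp (-2 * a)) := by
  have hR : 0 < R := by linarith
  have hN := h.nonneg_N hR
  have hG := h.nonneg_G hR
  have hM0 : 0 < M := (hV.deriv_pos 0).trans_le (hM 0)
  have hε : 0 ≤ ε := (abs_nonneg _).trans (hc 0 ⟨le_rfl, ha⟩).1
  obtain ⟨hκ1, hκ2⟩ := cosh_div_sinh_bounds hωR
  set κ := Real.cosh (ω * R) / Real.sinh (ω * R) with hκ
  have hS : 0 < Real.sinh (ω * R) := Real.sinh_pos_iff.2 (by linarith)
  set e : ℝ → ℝ := fun x => Real.sinh (ω * (R - x)) / Real.sinh (ω * R) with he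
  set k : ℝ → ℝ := fun x => Real.cosh (ω * (R - x)) / Real.sinh (ω * R) with hk
  have hlin : ∀ x : ℝ, HasDerivAt (fun y => ω * (R - y)) (-ω) x := fun x =>
    (((hasDerivAt_id x).const_sub R).const_mul ω).congr_deriv (by ring)
  have hde : ∀ x, HasDerivAt e (-ω * k x) x := fun x =>
    ((hlin x).sinh.div_const _).congr_deriv (by simp only [hk]; ring)
  have hdk : ∀ x, HasDerivAt k (-ω * e x) x := fun x =>
    ((hlin x).cosh.div_const _).congr_deriv (by simp only [he]; ring)
  have hce : Continuous e := continuous_iff_continuousAt.2 fun x => (hde x).continuousAt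
  have hck : Continuous k := continuous_iff_continuousAt.2 fun x => (hdk x).continuousAt
  have e0 : e 0 = 1 := by simp only [he, sub_zero]; exact div_self hS.ne'
  have eR : e R = 0 := by simp [he]
  have k0 : k 0 = κ := by simp only [hk, sub_zero, hκ]
  have hyb : ∀ x ∈ Icc 0 R, 0 ≤ ω * (R - x) ∧ ω * (R - x) ≤ ω * R := fun x hx =>
    ⟨mul_nonneg hω.le (by linarith [hx.2]), by nlinarith [hx.1]⟩
  have he1 : ∀ x ∈ Icc 0 R, |e x| ≤ 1 := by
    intro x hx
    obtain ⟨y1, y2⟩ := hyb x hx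
    rw [abs_of_nonneg (div_nonneg (Real.sinh_nonneg_iff.2 y1) hS.le), div_le_one hS]
    exact Real.sinh_le_sinh.2 y2
  have hk2 : ∀ x ∈ Icc 0 R, |k x| ≤ 2 := by
    intro x hx
    obtain ⟨y1, y2⟩ := hyb x hx
    rw [abs_of_pos (div_pos (Real.cosh_pos _) hS)]
    refine le_trans ?_ hκ2
    rw [hκ]
    gcongr
    rw [Real.cosh_le_cosh, abs_of_nonneg y1, abs_of_nonneg (y1.trans y2)]
    exact y2
  have hesub : ∀ x ∈ Icc 0 R, |1 - e x| ≤ 2 * ω * x := by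
    intro x hx
    have := abs_sub_le_of_abs_deriv_le hx.1 (b := fun y => 2 * ω * y) (b' := fun _ => 2 * ω * 1)
      hce.continuousOn (by fun_prop) (fun z _ => hde z)
      (fun z _ => (hasDerivAt_id z).const_mul _) (fun z hz => by
        rw [abs_mul, abs_neg, abs_of_pos hω]
        nlinarith [hk2 z ⟨hz.1.le, hz.2.le.trans hx.2⟩])
    rw [e0, abs_sub_comm] at this
    simpa using this
  have hksub : ∀ x ∈ Icc 0 R, |k x - κ| ≤ ω * x := by
    intro x hx
    have := abs_sub_le_of_abs_deriv_le hx.1 (b := fun y => ω * y) (b' := fun _ => ω * 1)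
      hck.continuousOn (by fun_prop) (fun z _ => hdk z)
      (fun z _ => (hasDerivAt_id z).const_mul _) (fun z hz => by
        rw [abs_mul, abs_neg, abs_of_pos hω]
        nlinarith [he1 z ⟨hz.1.le, hz.2.le.trans hx.2⟩])
    rw [k0] at this
    simpa using this
  -- the flux of the tested equation, completed by the primitive `Y`
  set T : ℝ → ℝ := fun x => e x * (deriv V₁ x * p' x + deriv V₂ x * q' x)
    - (V₁ x * V₂ x ^ 2 * e x - ω * k x * deriv V₁ x) * p x
    - (V₂ x * V₁ x ^ 2 * e x - ω * k x * deriv V₂ x) * q x + Y x with hT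
  have hsub : Icc 0 R ⊆ Icc (-R) R := Icc_subset_Icc_left (by linarith)
  have hsub' : Ioo 0 R ⊆ Ioo (-R) R := Ioo_subset_Ioo_left (by linarith)
  have hTc : ContinuousOn T (Icc 0 R) := by
    have c1 := h.cont_p.mono hsub
    have c2 := h.cont_q.mono hsub
    have c3 := h.cont_p'.mono hsub
    have c4 := h.cont_q'.mono hsub
    have c5 := h.cont_Y.mono hsub
    have c6 : Continuous V₁ := hV.contDiff_fst.continuous
    have c7 : Continuous V₂ := hV.contDiff_snd.continuous
    have c8 := hV.contDiff_fst.continuous_deriv (by norm_num)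
    have c9 := hV.contDiff_snd.continuous_deriv (by norm_num)
    fun_prop
  have hTd : ∀ x ∈ Ioo 0 R, HasDerivAt T ((1 - e x) * (deriv V₁ x * g₁ x + deriv V₂ x * g₂ x)
      + 2 * ω * k x * (V₁ x * V₂ x ^ 2 * p x + V₂ x * V₁ x ^ 2 * q x)) x := by
    intro x hx
    have hx' := hsub' hx
    have v1 := hV.hasDerivAt_fst x
    have v2 := hV.hasDerivAt_snd x
    have w1 := hV.hasDerivAt_deriv_fst x
    have w2 := hV.hasDerivAt_deriv_snd x
    have kk := (hdk x).const_mul ω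
    refine (((((hde x).fun_mul ((w1.fun_mul (h.deriv_p' x hx')).fun_add
      (w2.fun_mul (h.deriv_q' x hx')))).fun_sub
      ((((v1.fun_mul (v2.fun_pow 2)).fun_mul (hde x)).fun_sub (kk.fun_mul w1)).fun_mul
        (h.deriv_p x hx'))).fun_sub
      ((((v2.fun_mul (v1.fun_pow 2)).fun_mul (hde x)).fun_sub (kk.fun_mul w2)).fun_mul
        (h.deriv_q x hx'))).fun_add (h.deriv_Y x hx')).congr_deriv ?_
    simp only [Nat.cast_ofNat, Nat.reduceSub, pow_one]
    ring
  have hg : ∀ x ∈ Ioo 0 R, |(1 - e x) * (deriv V₁ x * g₁ x + deriv V₂ x * g₂ x)|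
      ≤ ω * (16 * M * G / θ * Real.exp (-(θ / 2) * x)) := by
    intro x hx
    have hx' := hsub' hx
    have a1 : |g₁ x| ≤ 2 * G * Real.exp (-(θ * x)) :=
      (h.g₁_le x hx').trans (div_cosh_le_exp hG _)
    have a2 : |g₂ x| ≤ 2 * G * Real.exp (-(θ * x)) :=
      (h.g₂_le x hx').trans (div_cosh_le_exp hG _)
    have a3 : |deriv V₁ x * g₁ x + deriv V₂ x * g₂ x|
        ≤ M * (2 * G * Real.exp (-(θ * x))) + M * (2 * G * Real.exp (-(θ * x))) := by
      refine (abs_add_le _ _).trans ?_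
      rw [abs_mul, abs_mul]
      exact add_le_add (mul_le_mul (hV.abs_deriv_fst_le hM x) a1 (abs_nonneg _) hM0.le)
        (mul_le_mul (hV.abs_deriv_snd_le hM x) a2 (abs_nonneg _) hM0.le)
    have a4 := mul_exp_neg_le (half_pos hθ) x
    rw [show -(2 * (θ / 2)) * x = -(θ * x) by ring] at a4
    rw [abs_mul]
    calc |1 - e x| * |deriv V₁ x * g₁ x + deriv V₂ x * g₂ x|
        ≤ (2 * ω * x) * (M * (2 * G * Real.exp (-(θ * x))) + M * (2 * G * Real.exp (-(θ * x)))) :=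
          mul_le_mul (hesub x (Ioo_subset_Icc_self hx)) a3 (abs_nonneg _)
            (mul_nonneg (by positivity) hx.1.le)
      _ = 8 * ω * M * G * (x * Real.exp (-(θ * x))) := by ring
      _ ≤ 8 * ω * M * G * (1 / (θ / 2) * Real.exp (-(θ / 2) * x)) := by gcongr
      _ = _ := by field_simp; ring
  have hW : ∀ x ∈ Ioo 0 R, ∀ y z b d : ℝ, |y| ≤ b → |z| ≤ b → 0 ≤ b → d = 2 * b →
      |V₁ x * V₂ x ^ 2 * y + V₂ x * V₁ x ^ 2 * z| ≤ K * Real.exp (-2 * x) * d := by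
    intro x hx y z b d hy hz hb hd
    have v1 := hV.pos_fst x
    have v2 := hV.pos_snd x
    have b1 := (hV.interaction_bounds hK hx.1.le).2.2
    have b2 := hK x hx.1.le
    refine (abs_add_le _ _).trans ?_
    rw [abs_mul _ y, abs_mul _ z, abs_of_pos (by positivity : 0 < V₁ x * V₂ x ^ 2),
      abs_of_pos (by positivity : 0 < V₂ x * V₁ x ^ 2)]
    have i1 := mul_le_mul b1 hy (abs_nonneg _) (by positivity)
    have i2 := mul_le_mul b2 hz (abs_nonneg _) (by positivity)
    rw [hd]
    linarith
  have hexp : ∀ (s z : ℝ), HasDerivAt (fun y => Real.exp (-s * y)) (-s * Real.exp (-s * z)) z := by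
    intro s z
    simpa [mul_comm] using ((hasDerivAt_id z).const_mul (-s)).exp
  have hexpI : ∀ (s z : ℝ), 0 < s → 0 ≤ z → Real.exp (-s * z) ≤ 1 := fun s z hs hz => by
    rw [Real.exp_le_one_iff]; nlinarith
  -- the inner interval, where `φ` is compared with `c V'`
  have inner := abs_sub_le_of_abs_deriv_le ha
    (f := fun x => T x - ω * κ * c * (deriv V₁ x ^ 2 + deriv V₂ x ^ 2))
    (f' := fun x => ((1 - e x) * (deriv V₁ x * g₁ x + deriv V₂ x * g₂ x)
      + 2 * ω * k x * (V₁ x * V₂ x ^ 2 * p x + V₂ x * V₁ x ^ 2 * q x))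
      - ω * κ * c * (2 * deriv V₁ x * (V₁ x * V₂ x ^ 2) + 2 * deriv V₂ x * (V₂ x * V₁ x ^ 2)))
    (b := fun x => -(ω * (32 * M * G / θ ^ 2)) * Real.exp (-(θ / 2) * x)
      + -(ω * (8 * K * ε + 4 * ω * K * M * |c|)) * Real.exp (-1 * x))
    (b' := fun x => -(ω * (32 * M * G / θ ^ 2)) * (-(θ / 2) * Real.exp (-(θ / 2) * x))
      + -(ω * (8 * K * ε + 4 * ω * K * M * |c|)) * (-1 * Real.exp (-1 * x)))
    (by
      have c1 := hTc.mono (Icc_subset_Icc_right haR.le)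
      have c8 := hV.contDiff_fst.continuous_deriv (by norm_num)
      have c9 := hV.contDiff_snd.continuous_deriv (by norm_num)
      fun_prop)
    (by fun_prop)
    (fun x hx => by
      refine ((hTd x (Ioo_subset_Ioo_right haR.le hx)).fun_sub
        ((((hV.hasDerivAt_deriv_fst x).fun_pow 2).fun_add
          ((hV.hasDerivAt_deriv_snd x).fun_pow 2)).const_mul _)).congr_deriv ?_
      simp only [Nat.cast_ofNat, Nat.reduceSub, pow_one])
    (fun x hx => ((hexp _ x).const_mul _).fun_add ((hexp _ x).const_mul _))
    (fun x hx => by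
      have hxR : x ∈ Ioo 0 R := Ioo_subset_Ioo_right haR.le hx
      have hxR' := Ioo_subset_Icc_self hxR
      have hφ := hc x (Ioo_subset_Icc_self hx)
      have i1 := hg x hxR
      have i2 := hW x hxR _ _ ε _ hφ.1 hφ.2 hε rfl
      have i3 := hW x hxR _ _ M _ (hV.abs_deriv_fst_le hM x) (hV.abs_deriv_snd_le hM x) hM0.le rfl
      set X₁ := V₁ x * V₂ x ^ 2 * (p x - c * deriv V₁ x)
        + V₂ x * V₁ x ^ 2 * (q x - c * deriv V₂ x) with hX₁
      set X₂ := V₁ x * V₂ x ^ 2 * deriv V₁ x + V₂ x * V₁ x ^ 2 * deriv V₂ x with hX₂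
      have hsplit : ((1 - e x) * (deriv V₁ x * g₁ x + deriv V₂ x * g₂ x)
          + 2 * ω * k x * (V₁ x * V₂ x ^ 2 * p x + V₂ x * V₁ x ^ 2 * q x))
          - ω * κ * c * (2 * deriv V₁ x * (V₁ x * V₂ x ^ 2) + 2 * deriv V₂ x * (V₂ x * V₁ x ^ 2))
          = (1 - e x) * (deriv V₁ x * g₁ x + deriv V₂ x * g₂ x)
            + 2 * ω * (k x * X₁) + 2 * ω * (c * ((k x - κ) * X₂)) := by
        rw [hX₁, hX₂]; ring
      have j2 : |2 * ω * (k x * X₁)| ≤ ω * (8 * K * ε) * Real.exp (-1 * x) := by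
        rw [abs_mul, abs_mul (k x), abs_of_pos (by positivity : 0 < 2 * ω)]
        have : Real.exp (-2 * x) ≤ Real.exp (-1 * x) := by
          rw [Real.exp_le_exp]; linarith [hx.1]
        calc 2 * ω * (|k x| * |X₁|) ≤ 2 * ω * (2 * (K * Real.exp (-1 * x) * (2 * ε))) := by
              gcongr
              · exact hk2 x hxR'
              · exact i2.trans (by gcongr)
          _ = _ := by ring
      have j3 : |2 * ω * (c * ((k x - κ) * X₂))|
          ≤ ω * (4 * ω * K * M * |c|) * Real.exp (-1 * x) := by
        rw [abs_mul, abs_mul c, abs_mul (k x - κ), abs_of_pos (by positivity : 0 < 2 * ω)]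
        have hx1 := mul_exp_neg_le (one_pos (α := ℝ)) x
        rw [mul_one, div_one, one_mul] at hx1
        have hx0 : 0 ≤ ω * x := mul_nonneg hω.le hx.1.le
        calc 2 * ω * (|c| * (|k x - κ| * |X₂|))
            ≤ 2 * ω * (|c| * ((ω * x) * (K * Real.exp (-2 * x) * (2 * M)))) := by
              gcongr
              exact hksub x hxR'
          _ = 4 * ω ^ 2 * K * M * |c| * (x * Real.exp (-2 * x)) := by ring
          _ ≤ 4 * ω ^ 2 * K * M * |c| * Real.exp (-1 * x) := by gcongr
          _ = _ := by ring
      have e1 : -(ω * (32 * M * G / θ ^ 2)) * (-(θ / 2) * Real.exp (-(θ / 2) * x))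
          = ω * (16 * M * G / θ * Real.exp (-(θ / 2) * x)) := by field_simp; ring
      rw [hsplit, e1]
      have := abs_add_le ((1 - e x) * (deriv V₁ x * g₁ x + deriv V₂ x * g₂ x)
            + 2 * ω * (k x * X₁)) (2 * ω * (c * ((k x - κ) * X₂)))
      have := abs_add_le ((1 - e x) * (deriv V₁ x * g₁ x + deriv V₂ x * g₂ x))
            (2 * ω * (k x * X₁))
      linarith)
  -- the outer interval, where `V''` is negligible
  have outer := abs_sub_le_of_abs_deriv_le haR.le (f := T)
    (b := fun x => -(ω * (32 * M * G / θ ^ 2)) * Real.exp (-(θ / 2) * x)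
      + -(ω * (4 * K * N)) * Real.exp (-2 * x))
    (b' := fun x => -(ω * (32 * M * G / θ ^ 2)) * (-(θ / 2) * Real.exp (-(θ / 2) * x))
      + -(ω * (4 * K * N)) * (-2 * Real.exp (-2 * x)))
    (hTc.mono (Icc_subset_Icc_left ha)) (by fun_prop)
    (fun x hx => hTd x (Ioo_subset_Ioo_left ha hx))
    (fun x hx => ((hexp _ x).const_mul _).fun_add ((hexp _ x).const_mul _))
    (fun x hx => by
      have hxR : x ∈ Ioo 0 R := Ioo_subset_Ioo_left ha hx
      have hxR' := Ioo_subset_Icc_self hxR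
      have i1 := hg x hxR
      have i2 := hW x hxR _ _ N _ (h.p_le x (hsub hxR')) (h.q_le x (hsub hxR')) hN rfl
      have j2 : |2 * ω * k x * (V₁ x * V₂ x ^ 2 * p x + V₂ x * V₁ x ^ 2 * q x)|
          ≤ ω * (8 * K * N) * Real.exp (-2 * x) := by
        rw [abs_mul, abs_mul, abs_of_pos (by positivity : 0 < 2 * ω)]
        calc _ ≤ 2 * ω * 2 * (K * Real.exp (-2 * x) * (2 * N)) := by
              gcongr
              exact hk2 x hxR'
          _ = _ := by ring
      have e1 : -(ω * (32 * M * G / θ ^ 2)) * (-(θ / 2) * Real.exp (-(θ / 2) * x))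
          = ω * (16 * M * G / θ * Real.exp (-(θ / 2) * x)) := by field_simp; ring
      rw [e1]
      refine (abs_add_le _ _).trans ?_
      linarith)
  have hTR : T R = Y R := by simp [hT, eR, h.p_right, h.q_right]
  have hT0 : T 0 = deriv V₁ 0 * p' 0 + deriv V₂ 0 * q' 0 - (p 0 + q 0)
      + ω * κ * (deriv V₁ 0 * p 0 + deriv V₂ 0 * q 0) + Y 0 := by
    simp only [hT, e0, k0, hV.fst_zero, hV.snd_zero]; ring
  have hφ0 : |ω * κ * (deriv V₁ 0 * (p 0 - c * deriv V₁ 0) + deriv V₂ 0 * (q 0 - c * deriv V₂ 0))|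
      ≤ ω * (4 * M * ε) := by
    obtain ⟨c1, c2⟩ := hc 0 ⟨le_rfl, ha⟩
    have := abs_add_le (deriv V₁ 0 * (p 0 - c * deriv V₁ 0)) (deriv V₂ 0 * (q 0 - c * deriv V₂ 0))
    rw [abs_mul (deriv V₁ 0), abs_mul (deriv V₂ 0)] at this
    have i1 := mul_le_mul (hV.abs_deriv_fst_le hM 0) c1 (abs_nonneg _) hM0.le
    have i2 := mul_le_mul (hV.abs_deriv_snd_le hM 0) c2 (abs_nonneg _) hM0.le
    rw [abs_mul, abs_of_pos (by positivity : 0 < ω * κ)]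
    calc _ ≤ ω * 2 * (2 * (M * ε)) := by gcongr; linarith
      _ = _ := by ring
  have hA0 : 0 ≤ ω * (32 * M * G / θ ^ 2) := by positivity
  have hB0 : 0 ≤ ω * (8 * K * ε + 4 * ω * K * M * |c|) := by positivity
  have hC0 : 0 ≤ ω * (4 * K * N) * Real.exp (-2 * R) := by positivity
  simp only [mul_zero, Real.exp_zero] at inner
  have r1 := mul_nonneg hA0 (Real.exp_pos (-(θ / 2) * a)).le
  have r2 := mul_nonneg hB0 (Real.exp_pos (-1 * a)).le
  have r3 := mul_nonneg hA0 (Real.exp_pos (-(θ / 2) * R)).le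
  have r4 := mul_le_mul_of_nonneg_left (hexpI (θ / 2) a (half_pos hθ) ha) hA0
  have etot : Y R - Y 0 - (deriv V₁ 0 * p' 0 + deriv V₂ 0 * q' 0 - (p 0 + q 0))
        - ω * κ * c * (deriv V₁ a ^ 2 + deriv V₂ a ^ 2)
      = (T R - T a) + ((T a - ω * κ * c * (deriv V₁ a ^ 2 + deriv V₂ a ^ 2))
          - (T 0 - ω * κ * c * (deriv V₁ 0 ^ 2 + deriv V₂ 0 ^ 2)))
        + ω * κ * (deriv V₁ 0 * (p 0 - c * deriv V₁ 0)
          + deriv V₂ 0 * (q 0 - c * deriv V₂ 0)) := by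
    rw [hTR, hT0]; ring
  rw [etot]
  refine (abs_add_three _ _ _).trans ?_
  have efin : ω * (64 * M / θ ^ 2 * G + (8 * K + 4 * M) * ε + 4 * ω * K * M * |c|
        + 4 * K * N * Real.exp (-2 * a))
      = 2 * (ω * (32 * M * G / θ ^ 2)) + ω * (8 * K * ε + 4 * ω * K * M * |c|)
        + ω * (4 * K * N) * Real.exp (-2 * a) + ω * (4 * M * ε) := by ring
  rw [efin]
  linarith

/-- The solvability condition bounds the coefficient of the kernel element `V'`. -/
lemma abs_coeff_le {V₁ V₂ : ℝ → ℝ} (hV : IsSegregationProfile V₁ V₂) {M K : ℝ}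
    (hM : ∀ x, deriv V₁ x ≤ M)
    (hK : ∀ x, 0 ≤ x → V₂ x * V₁ x ^ 2 ≤ K * Real.exp (-2 * x)) (hK0 : 0 < K)
    {ω R θ N G : ℝ} {p q p' q' g₁ g₂ Y : ℝ → ℝ}
    (h : IsBoundedSolution V₁ V₂ ω R θ N G p q p' q' g₁ g₂ Y) (hθ : 0 < θ) (hω : 0 < ω)
    (hωR : 1 ≤ ω * R) {a : ℝ} (ha : 0 ≤ a) (haR : a < R) {c ε : ℝ}
    (hc : ∀ x ∈ Icc (-a) a, |p x - c * deriv V₁ x| ≤ ε ∧ |q x - c * deriv V₂ x| ≤ ε) :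
    |c| * deriv V₁ 0 ^ 2 ≤ 64 * M / θ ^ 2 * G + (8 * K + 4 * M) * ε + 4 * ω * K * M * |c|
        + 4 * K * N * Real.exp (-2 * a) := by
  have h1 := h.half_line_identity hV hM hK hK0 hθ hω hωR ha haR (c := c) (ε := ε)
    (fun x hx => hc x ⟨by linarith [hx.1], hx.2⟩)
  have h2 := (h.reflect hV).half_line_identity hV hM hK hK0 hθ hω hωR ha haR (c := -c) (ε := ε)
    (fun x hx => by
      obtain ⟨c1, c2⟩ := hc (-x) ⟨by linarith [hx.2], by linarith [hx.1]⟩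
      rw [hV.deriv_fst_neg] at c1
      rw [hV.deriv_snd_neg] at c2
      exact ⟨by convert c2 using 2; ring, by convert c1 using 2; ring⟩)
  rw [abs_neg] at h2
  have hκ := (cosh_div_sinh_bounds hωR).1
  set κ := Real.cosh (ω * R) / Real.sinh (ω * R)
  set E := 64 * M / θ ^ 2 * G + (8 * K + 4 * M) * ε + 4 * ω * K * M * |c|
        + 4 * K * N * Real.exp (-2 * a)
  have hd0 : deriv V₂ 0 = -deriv V₁ 0 := by rw [hV.deriv_snd, neg_zero]
  simp only [neg_zero, hd0, h.Y_eq] at h1 h2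
  have h3 : |2 * ω * κ * c * (deriv V₁ a ^ 2 + deriv V₂ a ^ 2)| ≤ 2 * (ω * E) := by
    rw [abs_le] at h1 h2 ⊢
    constructor <;> linarith [h1.1, h1.2, h2.1, h2.2]
  have hd : deriv V₁ 0 ^ 2 ≤ deriv V₁ a ^ 2 + deriv V₂ a ^ 2 := by
    have := hV.monotone_deriv_fst ha
    have := hV.deriv_pos 0
    nlinarith [sq_nonneg (deriv V₂ a)]
  have e : |2 * ω * κ * c * (deriv V₁ a ^ 2 + deriv V₂ a ^ 2)|
      = 2 * (ω * (κ * (|c| * (deriv V₁ a ^ 2 + deriv V₂ a ^ 2)))) := by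
    rw [abs_mul, abs_mul, abs_of_pos (by positivity : 0 < 2 * ω * κ),
      abs_of_nonneg (by positivity : 0 ≤ deriv V₁ a ^ 2 + deriv V₂ a ^ 2)]
    ring
  rw [e] at h3
  have h4 : κ * (|c| * (deriv V₁ a ^ 2 + deriv V₂ a ^ 2)) ≤ E :=
    le_of_mul_le_mul_left (by linarith) hω
  have h5 : |c| * deriv V₁ 0 ^ 2 ≤ |c| * (deriv V₁ a ^ 2 + deriv V₂ a ^ 2) := by gcongr
  have h6 := le_mul_of_one_le_left
    (by positivity : 0 ≤ |c| * (deriv V₁ a ^ 2 + deriv V₂ a ^ 2)) hκ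
  linarith

end IsBoundedSolution

/-! ### The a priori estimate -/

namespace IsBoundedSolution

/-- Any bound `N` of a solution improves to `C G + N / 2`. The multiple `c` of the kernel element is
bounded by the solvability condition, the rest by the energy estimate and the exterior bounds; `a` is
chosen to make the factors `exp (-2a)` small, then `t` to make the remainder of size `N / t` small. -/
lemma exists_abs_le_add_half {V₁ V₂ : ℝ → ℝ} (hV : IsSegregationProfile V₁ V₂) {θ : ℝ}
    (hθ : 0 < θ) :
    ∃ C R₀ ω₀ : ℝ, 0 < C ∧ 0 < R₀ ∧ 0 < ω₀ ∧
      ∀ {ω R N G : ℝ} {p q p' q' g₁ g₂ Y : ℝ → ℝ},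
        IsBoundedSolution V₁ V₂ ω R θ N G p q p' q' g₁ g₂ Y → R₀ < R → 0 < ω → ω < ω₀ →
        1 ≤ ω * R → ∀ x ∈ Icc (-R) R, |p x| ≤ C * G + N / 2 ∧ |q x| ≤ C * G + N / 2 := by
  obtain ⟨M, hM0, hM⟩ := hV.exists_deriv_fst_le
  obtain ⟨K, hK0, hK⟩ := hV.exists_snd_mul_sq_fst_le
  set s := deriv V₁ 0 ^ 2 with hs
  have hs0 : 0 < s := by have := hV.deriv_pos 0; positivity
  set CN := 8 * K * M / s + 3 * K with hCN
  set CE := 2 * M * (8 * K + 4 * M) / s + 1 with hCE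
  set CG := 128 * M ^ 2 / (s * θ ^ 2) + 1 + 2 / θ ^ 2 with hCG
  have hCN0 : 0 < CN := by positivity
  have hCE0 : 0 < CE := by positivity
  have hCG0 : 0 < CG := by positivity
  set a := 1 + 2 * CN with ha
  have ha1 : 1 ≤ a := by linarith
  have hexp : CN * Real.exp (-2 * a) ≤ 1 / 4 := by
    have h1 := Real.add_one_le_exp (2 * a)
    have h2 : Real.exp (-2 * a) * Real.exp (2 * a) = 1 := by rw [← Real.exp_add]; simp
    nlinarith [Real.exp_pos (-2 * a)]
  obtain ⟨B, hB0, hB⟩ := exists_near_kernel hV hM hθ ha1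
  set τ := 4 * CE * B with hτ
  have hτ0 : 0 < τ := by positivity
  refine ⟨CG + CE * B * τ, a, s / (8 * K * M), by positivity, by positivity, by positivity, ?_⟩
  intro ω R N G p q p' q' g₁ g₂ Y h haR hω hω₀ hωR x hx
  have hR : 0 < R := by linarith
  have hG := h.nonneg_G hR
  rcases (h.nonneg_N hR).eq_or_lt with hN | hN
  · have h1 := h.p_le x hx
    have h2 := h.q_le x hx
    have : 0 ≤ (CG + CE * B * τ) * G := by positivity
    rw [← hN] at h1 h2 ⊢
    constructor <;> linarith
  obtain ⟨c, hc⟩ := hB h haR (τ / N) (by positivity)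
  set ε := B * (τ / N * (N * G) + 1 / (τ / N)) with hε
  have hε' : CE * ε = CE * B * τ * G + N / 4 := by
    rw [hε, hτ]; field_simp
  have hcoef := h.abs_coeff_le hV hM hK hK0 hθ hω hωR (by linarith) haR hc
  have hω1 : 4 * ω * K * M ≤ s / 2 := by
    rw [lt_div_iff₀ (by positivity)] at hω₀; linarith
  have hc1 : |c| ≤ 2 / s * (64 * M / θ ^ 2 * G + (8 * K + 4 * M) * ε
      + 4 * K * N * Real.exp (-2 * a)) := by
    have h1 := mul_le_mul_of_nonneg_right hω1 (abs_nonneg c)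
    rw [div_mul_eq_mul_div, le_div_iff₀ hs0]
    linarith
  have hD : ∀ y ∈ Icc (-a) a, |p y| ≤ |c| * M + ε ∧ |q y| ≤ |c| * M + ε := by
    intro y hy
    obtain ⟨c1, c2⟩ := hc y hy
    have b1 : |c * deriv V₁ y| ≤ |c| * M := by
      rw [abs_mul]; gcongr; exact hV.abs_deriv_fst_le hM y
    have b2 : |c * deriv V₂ y| ≤ |c| * M := by
      rw [abs_mul]; gcongr; exact hV.abs_deriv_snd_le hM y
    have t1 := abs_sub_abs_le_abs_sub (p y) (c * deriv V₁ y)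
    have t2 := abs_sub_abs_le_abs_sub (q y) (c * deriv V₂ y)
    constructor <;> linarith
  have hout := h.abs_le_of_inner hV hK hθ hω hK0 (by linarith) haR hD hx
  have hsum : |c| * M + ε + (1 + 2 / θ ^ 2) * G + 3 * K * N * Real.exp (-2 * a)
      ≤ (CG + CE * B * τ) * G + N / 2 := by
    have h1 := mul_le_mul_of_nonneg_right hc1 hM0.le
    have h2 : 2 / s * (64 * M / θ ^ 2 * G + (8 * K + 4 * M) * ε
        + 4 * K * N * Real.exp (-2 * a)) * M + ε + (1 + 2 / θ ^ 2) * G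
        + 3 * K * N * Real.exp (-2 * a)
        = CG * G + CE * ε + CN * Real.exp (-2 * a) * N := by
      rw [hCG, hCE, hCN]; field_simp; ring
    have h3 := mul_le_mul_of_nonneg_right hexp hN.le
    linarith
  exact ⟨hout.1.trans hsum, hout.2.trans hsum⟩

end IsBoundedSolution

/-! ### From classical solutions to bounded solutions in first order form -/

/-- A function with bounded second derivative on an open interval has a derivative which extends
continuously to the line. -/
lemma exists_continuous_deriv_of_bounded {f : ℝ → ℝ} {a b D : ℝ} (hf : ContDiffOn ℝ 2 f (Ioo a b))
    (hD : ∀ x ∈ Ioo a b, |deriv (deriv f) x| ≤ D) :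
    ∃ f' : ℝ → ℝ, Continuous f' ∧ (∀ x ∈ Ioo a b, HasDerivAt f (f' x) x) ∧
      ∀ x ∈ Ioo a b, HasDerivAt f' (deriv (deriv f) x) x := by
  have hf1 : ContDiffOn ℝ 1 (deriv f) (Ioo a b) :=
    ((contDiffOn_succ_iff_deriv_of_isOpen (n := 1) isOpen_Ioo).1 hf).2.2
  have hd1 : ∀ x ∈ Ioo a b, HasDerivAt f (deriv f x) x := fun x hx =>
    ((hf.differentiableOn (by norm_num)).differentiableAt (isOpen_Ioo.mem_nhds hx)).hasDerivAt
  have hd2 : ∀ x ∈ Ioo a b, HasDerivAt (deriv f) (deriv (deriv f) x) x := fun x hx =>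
    ((hf1.differentiableOn (by norm_num)).differentiableAt (isOpen_Ioo.mem_nhds hx)).hasDerivAt
  have hlip : LipschitzOnWith D.toNNReal (deriv f) (Ioo a b) :=
    (convex_Ioo a b).lipschitzOnWith_of_nnnorm_hasDerivWithin_le
      (fun x hx => (hd2 x hx).hasDerivWithinAt) fun x hx => by
        rw [← NNReal.coe_le_coe, coe_nnnorm, Real.norm_eq_abs]
        exact (hD x hx).trans (Real.le_coe_toNNReal D)
  obtain ⟨f', hf', heq⟩ := hlip.extend_real
  refine ⟨f', hf'.continuous, fun x hx => heq hx ▸ hd1 x hx, fun x hx => ?_⟩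
  refine (hd2 x hx).congr_of_eventuallyEq ?_
  filter_upwards [isOpen_Ioo.mem_nhds hx] with y hy using (heq hy).symm

lemma continuousOn_deriv_deriv {f : ℝ → ℝ} {a b : ℝ} (hf : ContDiffOn ℝ 2 f (Ioo a b)) :
    ContinuousOn (deriv (deriv f)) (Ioo a b) :=
  ((contDiffOn_succ_iff_deriv_of_isOpen (n := 1) isOpen_Ioo).1 hf).2.2.continuousOn_deriv_of_isOpen
    isOpen_Ioo (by norm_num)

lemma exists_primitive_of_integral_eq_zero {f : ℝ → ℝ} {a b D : ℝ} (hab : a ≤ b)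
    (hf : ContinuousOn f (Ioo a b)) (hD : ∀ x ∈ Ioo a b, |f x| ≤ D)
    (h0 : ∫ x in a..b, f x = 0) :
    ∃ F : ℝ → ℝ, ContinuousOn F (Icc a b) ∧ (∀ x ∈ Ioo a b, HasDerivAt F (f x) x) ∧
      F a = F b := by
  have hint : IntervalIntegrable f MeasureTheory.volume a b := by
    rw [intervalIntegrable_iff_integrableOn_Ioo_of_le hab]
    exact MeasureTheory.IntegrableOn.of_bound (by simp)
      (hf.aestronglyMeasurable measurableSet_Ioo) D
      ((MeasureTheory.ae_restrict_iff' measurableSet_Ioo).2 (Eventually.of_forall hD))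
  refine ⟨fun x => ∫ y in a..x, f y, ?_, fun x hx => ?_, by simp [h0]⟩
  · have := intervalIntegral.continuousOn_primitive_interval' hint left_mem_uIcc
    rwa [uIcc_of_le hab] at this
  · refine intervalIntegral.integral_hasDerivAt_right (hint.mono_set ?_)
      (hf.stronglyMeasurableAtFilter isOpen_Ioo x hx)
      (hf.continuousAt (isOpen_Ioo.mem_nhds hx))
    rw [uIcc_of_le hx.1.le, uIcc_of_le hab]
    exact Icc_subset_Icc_right hx.2.le

lemma IsDirichletSolution.exists_isBoundedSolution {V₁ V₂ : ℝ → ℝ}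
    (hV : IsSegregationProfile V₁ V₂) {ω R θ N G : ℝ} {φ g : ℝ → ℝ × ℝ}
    (h : IsDirichletSolution V₁ V₂ ω R φ g) (hR : 0 < R)
    (horth : (∫ x in (-R)..R, (deriv V₁ x * (g x).1 + deriv V₂ x * (g x).2)) = 0)
    (hN : ∀ x ∈ Icc (-R) R, ‖φ x‖ ≤ N) (hG : ∀ x ∈ Ioo (-R) R, ‖g x‖ ≤ G / Real.cosh (θ * x)) :
    ∃ p' q' Y : ℝ → ℝ, IsBoundedSolution V₁ V₂ ω R θ N G (fun x => (φ x).1) (fun x => (φ x).2)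
      p' q' (fun x => (g x).1) (fun x => (g x).2) Y := by
  have hp : ContDiffOn ℝ 2 (fun x => (φ x).1) (Ioo (-R) R) := h.contDiffOn.fst
  have hq : ContDiffOn ℝ 2 (fun x => (φ x).2) (Ioo (-R) R) := h.contDiffOn.snd
  have cp : ContinuousOn (fun x => (φ x).1) (Icc (-R) R) := h.continuousOn.fst
  have cq : ContinuousOn (fun x => (φ x).2) (Icc (-R) R) := h.continuousOn.snd
  have cV₁ : Continuous V₁ := hV.contDiff_fst.continuous
  have cV₂ : Continuous V₂ := hV.contDiff_snd.continuous
  have cV₁' := hV.contDiff_fst.continuous_deriv (by norm_num)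
  have cV₂' := hV.contDiff_snd.continuous_deriv (by norm_num)
  have ep : ∀ x ∈ Ioo (-R) R, deriv (deriv fun x => (φ x).1) x
      = V₂ x ^ 2 * (φ x).1 + 2 * V₁ x * V₂ x * (φ x).2 + ω ^ 2 * (φ x).1 - (g x).1 := by
    intro x hx
    rw [← h.eq x hx, linearizedOp]
    ring
  have eq : ∀ x ∈ Ioo (-R) R, deriv (deriv fun x => (φ x).2) x
      = V₁ x ^ 2 * (φ x).2 + 2 * V₁ x * V₂ x * (φ x).1 + ω ^ 2 * (φ x).2 - (g x).2 := by
    intro x hx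
    rw [← h.eq x hx, linearizedOp]
    ring
  have g1 : ∀ x ∈ Ioo (-R) R, |(g x).1| ≤ G / Real.cosh (θ * x) := fun x hx =>
    (norm_fst_le (g x)).trans (hG x hx)
  have g2 : ∀ x ∈ Ioo (-R) R, |(g x).2| ≤ G / Real.cosh (θ * x) := fun x hx =>
    (norm_snd_le (g x)).trans (hG x hx)
  have hG0 : 0 ≤ G := by simpa using (norm_nonneg _).trans (hG 0 ⟨by linarith, hR⟩)
  have hGle : ∀ x, G / Real.cosh (θ * x) ≤ G := fun x => div_le_self hG0 (Real.one_le_cosh _)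
  obtain ⟨D₁, hD₁⟩ := isCompact_Icc.exists_bound_of_continuousOn (s := Icc (-R) R)
    (f := fun x => V₂ x ^ 2 * (φ x).1 + 2 * V₁ x * V₂ x * (φ x).2 + ω ^ 2 * (φ x).1) (by fun_prop)
  obtain ⟨D₂, hD₂⟩ := isCompact_Icc.exists_bound_of_continuousOn (s := Icc (-R) R)
    (f := fun x => V₁ x ^ 2 * (φ x).2 + 2 * V₁ x * V₂ x * (φ x).1 + ω ^ 2 * (φ x).2) (by fun_prop)
  obtain ⟨p', cp', hp1, hp2⟩ := exists_continuous_deriv_of_bounded (D := D₁ + G) hp fun x hx => by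
    rw [ep x hx]
    exact (abs_sub _ _).trans
      (add_le_add (hD₁ x (Ioo_subset_Icc_self hx)) ((g1 x hx).trans (hGle x)))
  obtain ⟨q', cq', hq1, hq2⟩ := exists_continuous_deriv_of_bounded (D := D₂ + G) hq fun x hx => by
    rw [eq x hx]
    exact (abs_sub _ _).trans
      (add_le_add (hD₂ x (Ioo_subset_Icc_self hx)) ((g2 x hx).trans (hGle x)))
  have cg : ContinuousOn g (Ioo (-R) R) := by
    have c1 := continuousOn_deriv_deriv hp
    have c2 := continuousOn_deriv_deriv hq
    have c3 := cp.mono Ioo_subset_Icc_self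
    have c4 := cq.mono Ioo_subset_Icc_self
    refine ContinuousOn.congr (f := linearizedOp V₁ V₂ ω φ) ?_ fun x hx => (h.eq x hx).symm
    unfold linearizedOp
    fun_prop
  obtain ⟨M, hM0, hM⟩ := hV.exists_deriv_fst_le
  obtain ⟨Y, cY, hY, eY⟩ := exists_primitive_of_integral_eq_zero (by linarith)
    (f := fun x => deriv V₁ x * (g x).1 + deriv V₂ x * (g x).2) (D := M * G + M * G)
    (by have c1 := cg.fst; have c2 := cg.snd; fun_prop)
    (fun x hx => by
      refine (abs_add_le _ _).trans ?_
      rw [abs_mul, abs_mul]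
      exact add_le_add
        (mul_le_mul (hV.abs_deriv_fst_le hM x) ((g1 x hx).trans (hGle x)) (abs_nonneg _) hM0.le)
        (mul_le_mul (hV.abs_deriv_snd_le hM x) ((g2 x hx).trans (hGle x)) (abs_nonneg _) hM0.le))
    horth
  exact ⟨p', q', Y,
    { cont_p := cp, cont_q := cq, cont_p' := cp'.continuousOn, cont_q' := cq'.continuousOn
      cont_Y := cY, deriv_p := hp1, deriv_q := hq1
      deriv_p' := fun x hx => ep x hx ▸ hp2 x hx
      deriv_q' := fun x hx => eq x hx ▸ hq2 x hx
      deriv_Y := hY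
      p_left := by simp [h.left], p_right := by simp [h.right]
      q_left := by simp [h.left], q_right := by simp [h.right]
      Y_eq := eY
      p_le := fun x hx => (norm_fst_le (φ x)).trans (hN x hx)
      q_le := fun x hx => (norm_snd_le (φ x)).trans (hN x hx)
      g₁_le := g1, g₂_le := g2 }⟩

theorem mainTheorem3 (V₁ V₂ : ℝ → ℝ) (hV : IsSegregationProfile V₁ V₂) (θ : ℝ) (hθ : 0 < θ) :
    ∃ C R₀ ω₀ P₀ : ℝ, 0 < C ∧ 0 < R₀ ∧ 0 < ω₀ ∧ 0 < P₀ ∧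
      ∀ (R ω : ℝ) (φ g : ℝ → ℝ × ℝ), R₀ < R → 0 < ω → ω < ω₀ → P₀ < ω * R →
        IsDirichletSolution V₁ V₂ ω R φ g →
        (∫ x in (-R)..R, (deriv V₁ x * (g x).1 + deriv V₂ x * (g x).2)) = 0 →
        c0Norm (Ioo (-R) R) φ ≤ ENNReal.ofReal C * c0WeightedNorm θ (Ioo (-R) R) g := by
  obtain ⟨C, R₀, ω₀, hC, hR₀, hω₀, key⟩ := IsBoundedSolution.exists_abs_le_add_half hV hθ
  refine ⟨2 * C, R₀, ω₀, 1, by positivity, hR₀, hω₀, one_pos, ?_⟩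
  intro R ω φ g hR hω hωlt hωR hsol horth
  have hR0 : 0 < R := hR₀.trans hR
  -- the estimate is void when the weighted norm of `g` is infinite
  rcases eq_or_ne (c0WeightedNorm θ (Ioo (-R) R) g) ⊤ with htop | htop
  · rw [htop, ENNReal.mul_top (by simpa using hC)]
    exact le_top
  set G := (c0WeightedNorm θ (Ioo (-R) R) g).toReal with hGdef
  have hG : ∀ x ∈ Ioo (-R) R, ‖g x‖ ≤ G / Real.cosh (θ * x) := by
    intro x hx
    rw [le_div_iff₀ (Real.cosh_pos _)]
    have h1 : ‖Real.cosh (θ * x) • g x‖ₑ ≤ c0WeightedNorm θ (Ioo (-R) R) g :=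
      le_iSup₂ (f := fun x (_ : x ∈ Ioo (-R) R) => ‖Real.cosh (θ * x) • g x‖ₑ) x hx
    have h2 := ENNReal.toReal_mono htop h1
    rw [toReal_enorm, norm_smul, Real.norm_eq_abs, abs_of_pos (Real.cosh_pos _)] at h2
    linarith
  obtain ⟨z, hz, hmax⟩ := isCompact_Icc.exists_isMaxOn (nonempty_Icc.2 (by linarith : -R ≤ R))
    hsol.continuousOn.norm
  have hN : ∀ x ∈ Icc (-R) R, ‖φ x‖ ≤ ‖φ z‖ := fun x hx => hmax hx
  obtain ⟨p', q', Y, hb⟩ := hsol.exists_isBoundedSolution hV hR0 horth hN hG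
  have hz' := key hb hR hω hωlt hωR.le z hz
  have hbound : ‖φ z‖ ≤ 2 * C * G := by
    have : ‖φ z‖ ≤ C * G + ‖φ z‖ / 2 := by
      rw [Prod.norm_def] at hz' ⊢
      exact max_le hz'.1 hz'.2
    linarith
  have hfin : ENNReal.ofReal (2 * C) * c0WeightedNorm θ (Ioo (-R) R) g
      = ENNReal.ofReal (2 * C * G) := by
    rw [ENNReal.ofReal_mul (by positivity : 0 ≤ 2 * C), hGdef, ENNReal.ofReal_toReal htop]
  rw [hfin]
  refine iSup₂_le fun x hx => ?_
  rw [← ofReal_norm]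
  exact ENNReal.ofReal_le_ofReal ((hN x (Ioo_subset_Icc_self hx)).trans hbound)
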